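/- **Setting (Basic Assumptions).** Let $\gamma>0$, let $(Z_n)_{n\in\mathbb Z}$ be i.i.d. real random variables with distribution function $G_Z$, and let $(c_j)_{j\ge 0}$ be real coefficients, not all zero, with $\sum_{j\ge0}|c_j|^{\delta}<\infty$ for some $0<\delta<\min(1/\gamma,1)$. Suppose that, as $z\to\infty$, $$\frac{1-G_Z(z)}{z^{-1/\gamma}L(z)}\to\pi_1,\qquad \frac{G_Z(-z)}{z^{-1/\gamma}L(z)}\to\pi_2,$$ where $\pi_1,\pi_2\ge 0$, $\pi_1+\pi_2=1$, and $L$ is slowly varying, i.e. $L(yz)/L(z)\to1$ as $z\to\infty$ for every $y>0$. Let $X_n=\sum_{j=0}^\infty c_jZ_{n-j}$ (almost surely). Let $F_{|X|}$ be the distribution function of $|X_n|$, which does not depend on $n$, put $b_{|X|}(t)=\inf\{y: 1/(1-F_{|X|}(y))\ge t\}$, and let $|X|_{n,1}\le\dots\le|X|_{n,n}$ be the order statistics of $|X_1|,\dots,|X_n|$ (with $|X|_{n,i}:=0$ for $i\le 0$). **Lemma 1.** As $n,k,n/k\to\infty$: (a) for every $z>0$, $$\frac1k\sum_{i=1}^n\mathbf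 1\left\{\frac{|X_i|}{b_{|X|}(n/k)}>z\right\}\ \overset{P}{\to}\ z^{-1/\gamma};$$ (b) the random functions $s\mapsto |X|_{n,n-\lceil ks\rceil}/b_{|X|}(n/k)$ converge in probability to $s\mapsto s^{-\gamma}$ in $D[0,\infty)$, the space of left-continuous functions with right limits from $[0,\infty)$ to $[0,\infty]$ (where $0^{-\gamma}=\infty$), with the Skorokhod $J_1$ metric. For the finite values this means that, for all $0<a\le b<\infty$, $$\sup_{a\le s\le b}\left|\frac{|X|_{n,n-\lceil ks\rceil}}{b_{|X|}(n/k)}-s^{-\gamma}\right|\ \overset{P}{\to}\ 0,$$ which is part of the assertion. -/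

import Mathlib

open MeasureTheory ProbabilityTheory Filter Topology
open scoped NNReal ENNReal

/-- Slow variation at infinity: `L (y z) / L z → 1` as `z → ∞`, for every `y > 0`. -/
def SlowlyVarying (L : ℝ → ℝ) : Prop :=
  ∀ y : ℝ, 0 < y → Tendsto (fun z : ℝ => L (y * z) / L z) atTop (𝓝 1)

/-- The Basic Assumptions: `X` is the linear process with coefficients `c` and i.i.d. innovations
`Z` whose two tails are regularly varying with index `-1/γ` and balanced by `π₁`, `π₂`.
`G_Z z ∼ π z^{-1/γ} L z` is read as convergence of the quotient by `z^{-1/γ} L z` to `π`,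
which is meaningful also for `π = 0`. -/
structure BasicAssumptions {Ω : Type*} [MeasurableSpace Ω] (P : Measure Ω)
    (γ π₁ π₂ : ℝ) (L : ℝ → ℝ) (c : ℕ → ℝ) (Z X : ℤ → Ω → ℝ) : Prop where
  gamma_pos : 0 < γ
  innov_measurable : ∀ i, Measurable (Z i)
  innov_indep : iIndepFun Z P
  innov_identDistrib : ∀ i, IdentDistrib (Z i) (Z 0) P P
  /-- `X_n = ∑_{j ≥ 0} c_j Z_{n-j}` almost surely -/
  linear : ∀ n : ℤ, ∀ᵐ ω ∂P, HasSum (fun j : ℕ => c j * Z (n - (j : ℤ)) ω) (X n ω)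
  pi₁_nonneg : 0 ≤ π₁
  pi₂_nonneg : 0 ≤ π₂
  pi_add : π₁ + π₂ = 1
  slowly_varying : SlowlyVarying L
  right_tail : Tendsto
    (fun z : ℝ => (1 - P.real {ω | Z 0 ω ≤ z}) / (z ^ (-1 / γ) * L z)) atTop (𝓝 π₁)
  left_tail : Tendsto
    (fun z : ℝ => P.real {ω | Z 0 ω ≤ -z} / (z ^ (-1 / γ) * L z)) atTop (𝓝 π₂)
  coeff_ne_zero : ∃ j, c j ≠ 0
  coeff_summable : ∃ δ : ℝ, 0 < δ ∧ δ < min (1 / γ) 1 ∧ Summable (fun j => |c j| ^ δ)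

/-- The quantile function `b_{|Y|}(t) = inf {y : 1 / (1 - F_{|Y|}(y)) ≥ t}`, where `F_{|Y|}` is the
distribution function of `|Y|` and `1 / 0 = ∞`. -/
noncomputable def absQuantile {Ω : Type*} [MeasurableSpace Ω] (P : Measure Ω)
    (Y : Ω → ℝ) (t : ℝ) : ℝ :=
  sInf {y : ℝ | ENNReal.ofReal t ≤ (1 - P {ω | |Y ω| ≤ y})⁻¹}

/-- The scaling `b_{|X|}(n/k)`; the marginal law of `|X_n|` does not depend on `n`. -/
noncomputable def scale {Ω : Type*} [MeasurableSpace Ω] (P : Measure Ω)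
    (X : ℤ → Ω → ℝ) (n k : ℕ) : ℝ :=
  absQuantile P (X 1) ((n : ℝ) / (k : ℝ))

/-- The limit regime `n, k, n/k → ∞` on pairs `(n, k)`. -/
noncomputable def tailRegime : Filter (ℕ × ℕ) :=
  comap (fun p => p.1) atTop ⊓ comap (fun p => p.2) atTop ⊓
    comap (fun p => (p.1 : ℝ) / (p.2 : ℝ)) atTop

/-- `μ_X(z, ∞] = (1/k) ∑_{i=1}^n 1{|X_i| / b_{|X|}(n/k) > z}`. -/
noncomputable def tailEmpirical {Ω : Type*} [MeasurableSpace Ω] (P : Measure Ω)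
    (X : ℤ → Ω → ℝ) (n k : ℕ) (z : ℝ) (ω : Ω) : ℝ :=
  (1 / (k : ℝ)) *
    ∑ i ∈ Finset.Icc 1 n, (Set.Ioi z).indicator (fun _ => (1 : ℝ)) (|X (i : ℤ) ω| / scale P X n k)

/-- The `i`-th smallest of the numbers `x_0, …, x_{n-1}` for `1 ≤ i ≤ n` (and `0` for other `i`). -/
noncomputable def orderStat {n : ℕ} (x : Fin n → ℝ) (i : ℕ) : ℝ :=
  if h : 1 ≤ i ∧ i ≤ n then x (Tuple.sort x ⟨i - 1, by omega⟩) else 0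

/-- `|X|_{n,i}`, the `i`-th smallest of `|X_1|, …, |X_n|`. -/
noncomputable def absOrderStat {Ω : Type*} (X : ℤ → Ω → ℝ) (n i : ℕ) (ω : Ω) : ℝ :=
  orderStat (fun j : Fin n => |X ((j : ℤ) + 1) ω|) i

/-- `|X|_{n, n - ⌈ks⌉} / b_{|X|}(n/k)`. -/
noncomputable def tailQuantile {Ω : Type*} [MeasurableSpace Ω] (P : Measure Ω)
    (X : ℤ → Ω → ℝ) (n k : ℕ) (s : ℝ) (ω : Ω) : ℝ :=
  absOrderStat X n (n - ⌈(k : ℝ) * s⌉₊) ω / scale P X n k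

/-- The Skorokhod space `D[0,∞)` of functions on `[0,∞)` with values in `[0,∞]`, in its
left-continuous version (left-continuous with right limits), since `s ↦ ⌈ks⌉` is left-continuous. -/
structure SkorokhodD where
  toFun : ℝ≥0 → ℝ≥0∞
  left_cont : ∀ s, ContinuousWithinAt toFun (Set.Iic s) s
  right_lim : ∀ s, ∃ y, Tendsto toFun (𝓝[>] s) (𝓝 y)

namespace SkorokhodD

/-- A metric, bounded by `1`, inducing the topology of `[0,∞]`:
`|1 / (1 + x) - 1 / (1 + y)|`, with `1 / ∞ = 0`. -/
noncomputable def valueDist (x y : ℝ≥0∞) : ℝ≥0∞ :=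
  edist ((1 + x)⁻¹).toReal ((1 + y)⁻¹).toReal

/-- The size `sup_{s < t} |log ((lam t - lam s) / (t - s))|` of a time change `lam`. -/
noncomputable def timeChangeSize (lam : ℝ≥0 ≃o ℝ≥0) : ℝ≥0∞ :=
  ⨆ (s : ℝ≥0) (t : ℝ≥0) (_ : s < t),
    ENNReal.ofReal |Real.log (((lam t : ℝ) - (lam s : ℝ)) / ((t : ℝ) - (s : ℝ)))|

/-- The Skorokhod (J1) metric on `D[0,∞)`: the infimum over the time changes `lam` of
`max (size lam) (∫_0^∞ e^{-u} sup_t d (x (t ∧ u)) (y (lam t ∧ u)) du)`. -/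
noncomputable instance : EDist SkorokhodD where
  edist x y := ⨅ lam : ℝ≥0 ≃o ℝ≥0, max (timeChangeSize lam)
    (∫⁻ u in Set.Ioi (0 : ℝ), ENNReal.ofReal (Real.exp (-u)) *
      ⨆ t : ℝ≥0, valueDist (x.toFun (min t u.toNNReal)) (y.toFun (min (lam t) u.toNNReal)))

/-- The function `s ↦ s^{-γ}` on `[0,∞)`, with the value `∞` at `0` when `γ > 0`. -/
noncomputable def power (γ : ℝ) : SkorokhodD where
  toFun s := (s : ℝ≥0∞) ^ (-γ)
  left_cont _ :=
    ((ENNReal.continuous_rpow_const.comp ENNReal.continuous_coe).continuousAt).continuousWithinAt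
  right_lim s := ⟨_, ((ENNReal.continuous_rpow_const.comp
    ENNReal.continuous_coe).tendsto s).mono_left nhdsWithin_le_nhds⟩

/-- The left-continuous step function `s ↦ g ⌈ks⌉`. -/
noncomputable def ofCeil (k : ℕ) (g : ℕ → ℝ≥0∞) : SkorokhodD where
  toFun s := g ⌈(k : ℝ) * (s : ℝ)⌉₊
  left_cont s := by
    apply tendsto_const_nhds.congr'
    have hc : Continuous (fun r : ℝ≥0 => (k : ℝ) * (r : ℝ)) := by fun_prop
    rcases Nat.eq_zero_or_pos ⌈(k : ℝ) * (s : ℝ)⌉₊ with h0 | h0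
    · filter_upwards [self_mem_nhdsWithin] with r hr
      have hrs : (r : ℝ) ≤ s := by exact_mod_cast hr
      have : ⌈(k : ℝ) * (r : ℝ)⌉₊ ≤ ⌈(k : ℝ) * (s : ℝ)⌉₊ := Nat.ceil_mono (by gcongr)
      congr 1
      omega
    · have hlt : ((⌈(k : ℝ) * (s : ℝ)⌉₊ - 1 : ℕ) : ℝ) < (k : ℝ) * (s : ℝ) :=
        Nat.lt_ceil.1 (by omega)
      filter_upwards [self_mem_nhdsWithin,
        nhdsWithin_le_nhds (hc.continuousAt.eventually (lt_mem_nhds hlt))] with r hr hr2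
      have hrs : (r : ℝ) ≤ s := by exact_mod_cast hr
      have h1 : ⌈(k : ℝ) * (r : ℝ)⌉₊ ≤ ⌈(k : ℝ) * (s : ℝ)⌉₊ := Nat.ceil_mono (by gcongr)
      have h2 := Nat.lt_ceil.2 hr2
      congr 1
      omega
  right_lim s := by
    have hc : Continuous (fun r : ℝ≥0 => (k : ℝ) * (r : ℝ)) := by fun_prop
    rcases Nat.eq_zero_or_pos k with hk | hk
    · subst hk
      exact ⟨g 0, by simp⟩
    · refine ⟨g (⌊(k : ℝ) * (s : ℝ)⌋₊ + 1), ?_⟩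
      apply tendsto_const_nhds.congr'
      have hk' : (0 : ℝ) < k := by exact_mod_cast hk
      have hlt : (k : ℝ) * (s : ℝ) < ((⌊(k : ℝ) * (s : ℝ)⌋₊ + 1 : ℕ) : ℝ) := by
        push_cast
        exact Nat.lt_floor_add_one _
      filter_upwards [self_mem_nhdsWithin,
        nhdsWithin_le_nhds (hc.continuousAt.eventually (gt_mem_nhds hlt))] with r hr hr2
      have hrs : (s : ℝ) < r := by exact_mod_cast hr
      have h1 : (⌊(k : ℝ) * (s : ℝ)⌋₊ : ℝ) < (k : ℝ) * (r : ℝ) :=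
        (Nat.floor_le (by positivity)).trans_lt (by gcongr)
      have h2 := Nat.lt_ceil.2 h1
      have h3 : ⌈(k : ℝ) * (r : ℝ)⌉₊ ≤ ⌊(k : ℝ) * (s : ℝ)⌋₊ + 1 := Nat.ceil_le.2 hr2.le
      congr 1
      omega

end SkorokhodD

/-- The random path `s ↦ |X|_{n, n - ⌈ks⌉} / b_{|X|}(n/k)` as an element of `D[0,∞)`. -/
noncomputable def tailQuantilePath {Ω : Type*} [MeasurableSpace Ω] (P : Measure Ω)
    (X : ℤ → Ω → ℝ) (n k : ℕ) (ω : Ω) : SkorokhodD :=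
  SkorokhodD.ofCeil k (fun m => ENNReal.ofReal (absOrderStat X n (n - m) ω / scale P X n k))

/-- A positive antitone function that is regularly varying at infinity with index `-α`. -/
structure RegVarTail (H : ℝ → ℝ) (α : ℝ) : Prop where
  anti : Antitone H
  pos : ∀ z, 0 < H z
  ratio : ∀ y : ℝ, 0 < y → Tendsto (fun z => H (y * z) / H z) atTop (𝓝 (y ^ (-α)))

namespace RegVarTail

variable {H : ℝ → ℝ} {α : ℝ}

lemma exists_doubling_le (hH : RegVarTail H α) {β : ℝ} (hβ : β < α) :
    ∃ z₀ : ℝ, 0 < z₀ ∧ ∀ z, z₀ ≤ z → H (2 * z) ≤ 2 ^ (-β) * H z := by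
  have h : (2 : ℝ) ^ (-α) < 2 ^ (-β) := Real.rpow_lt_rpow_of_exponent_lt (by norm_num) (by linarith)
  obtain ⟨z₁, hz₁⟩ := eventually_atTop.1 ((hH.ratio 2 two_pos).eventually (gt_mem_nhds h))
  refine ⟨max z₁ 1, by positivity, fun z hz => ?_⟩
  exact ((div_lt_iff₀ (hH.pos z)).1 (hz₁ z ((le_max_left _ _).trans hz))).le

lemma exists_le_doubling (hH : RegVarTail H α) {q : ℝ} (hq : α < q) :
    ∃ z₀ : ℝ, 0 < z₀ ∧ ∀ z, z₀ ≤ z → H z ≤ 2 ^ q * H (2 * z) := by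
  have h : (2 : ℝ) ^ (-q) < 2 ^ (-α) := Real.rpow_lt_rpow_of_exponent_lt (by norm_num) (by linarith)
  obtain ⟨z₁, hz₁⟩ := eventually_atTop.1 ((hH.ratio 2 two_pos).eventually (lt_mem_nhds h))
  refine ⟨max z₁ 1, by positivity, fun z hz => ?_⟩
  have h1 := (lt_div_iff₀ (hH.pos z)).1 (hz₁ z ((le_max_left _ _).trans hz))
  have h2 : (0 : ℝ) < 2 ^ q := by positivity
  calc H z = 2 ^ q * (2 ^ (-q) * H z) := by
        rw [← mul_assoc, ← Real.rpow_add two_pos]; simp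
    _ ≤ _ := by gcongr

/-- Potter's upper bound. -/
lemma potter (hH : RegVarTail H α) {β : ℝ} (hβ0 : 0 ≤ β) (hβ : β < α) :
    ∃ z₀ : ℝ, 0 < z₀ ∧ ∀ z, z₀ ≤ z → ∀ y, 1 ≤ y → H (y * z) ≤ 2 ^ β * y ^ (-β) * H z := by
  obtain ⟨z₀, hz₀, hd⟩ := hH.exists_doubling_le hβ
  refine ⟨z₀, hz₀, fun z hz y hy => ?_⟩
  have hzpos : 0 < z := hz₀.trans_le hz
  have key : ∀ n : ℕ, H (2 ^ n * z) ≤ (2 ^ (-β)) ^ n * H z := by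
    intro n
    induction n with
    | zero => simp
    | succ n ih =>
      have h1 : (1 : ℝ) ≤ 2 ^ n := one_le_pow₀ (by norm_num)
      calc H (2 ^ (n + 1) * z) = H (2 * (2 ^ n * z)) := by ring_nf
        _ ≤ 2 ^ (-β) * H (2 ^ n * z) := hd _ (by nlinarith)
        _ ≤ 2 ^ (-β) * ((2 ^ (-β)) ^ n * H z) := by gcongr
        _ = _ := by ring
  obtain ⟨n, hn1, hn2⟩ := exists_nat_pow_near hy (one_lt_two)
  have h3 : ((2 : ℝ) ^ (-β)) ^ (n + 1) ≤ y ^ (-β) := by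
    rw [← Real.rpow_natCast, ← Real.rpow_mul two_pos.le, mul_comm, Real.rpow_mul two_pos.le,
      Real.rpow_natCast]
    exact Real.rpow_le_rpow_of_nonpos (by linarith) hn2.le (by linarith)
  calc H (y * z) ≤ H (2 ^ n * z) := hH.anti (by gcongr)
    _ ≤ (2 ^ (-β)) ^ n * H z := key n
    _ = 2 ^ β * (2 ^ (-β)) ^ (n + 1) * H z := by
        rw [pow_succ, mul_comm _ ((2 : ℝ) ^ (-β)), ← mul_assoc ((2 : ℝ) ^ β),
          ← Real.rpow_add two_pos]
        simp
    _ ≤ _ := by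
        have := (hH.pos z).le
        gcongr

/-- Regular variation of an antitone function asymptotically proportional to a function `D`
with the right limit ratios. -/
lemma of_tendsto_div {F D : ℝ → ℝ} {s : ℝ} (hF : Antitone F)
    (hFnonneg : ∀ z, 0 ≤ F z) (hs : 0 < s) (h : Tendsto (fun z => F z / D z) atTop (𝓝 s))
    (hD : ∀ y : ℝ, 0 < y → Tendsto (fun z => D (y * z) / D z) atTop (𝓝 (y ^ (-α)))) :
    RegVarTail F α := by
  have hev : ∀ᶠ z in atTop, 0 < F z ∧ D z ≠ 0 := by
    filter_upwards [h.eventually (lt_mem_nhds hs)] with z hz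
    refine ⟨(hFnonneg z).lt_of_ne fun h0 => ?_, fun h0 => ?_⟩
    · rw [← h0] at hz; simp at hz
    · rw [h0] at hz; simp at hz
  refine ⟨hF, fun z => ?_, fun y hy => ?_⟩
  · obtain ⟨w, hw1, hw2⟩ := (hev.and (eventually_ge_atTop z)).exists
    exact hw1.1.trans_le (hF hw2)
  · have hlim : Tendsto (fun z : ℝ => y * z) atTop atTop := tendsto_id.const_mul_atTop hy
    have h1 : Tendsto (fun z => F (y * z) / D (y * z)) atTop (𝓝 s) := h.comp hlim
    have h2 := (h1.mul (hD y hy)).div h hs.ne'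
    rw [mul_comm, mul_div_cancel_right₀ _ hs.ne'] at h2
    refine h2.congr' ?_
    filter_upwards [hev, hlim.eventually hev] with z hz hz'
    have := hz.1.ne'
    have := hz.2
    have := hz'.2
    simp only [Pi.div_apply]
    field_simp

end RegVarTail

section Tail

variable {Ω : Type*} [MeasurableSpace Ω]

/-- The tail function `z ↦ P(|Y| > z)`. -/
noncomputable def absTail (P : Measure Ω) (Y : Ω → ℝ) (z : ℝ) : ℝ := P.real {ω | z < |Y ω|}

variable {P : Measure Ω}

lemma absTail_nonneg (Y : Ω → ℝ) (z : ℝ) : 0 ≤ absTail P Y z := measureReal_nonneg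

variable [IsProbabilityMeasure P]

lemma absTail_antitone (Y : Ω → ℝ) : Antitone (absTail P Y) := fun _ _ h =>
  measureReal_mono fun _ hω => lt_of_le_of_lt h hω

lemma ofReal_absTail (Y : Ω → ℝ) (z : ℝ) :
    ENNReal.ofReal (absTail P Y z) = P {ω | z < |Y ω|} := ofReal_measureReal

lemma lintegral_min_rpow_le {Y : Ω → ℝ} (hY : Measurable Y) {α p : ℝ}
    (hH : RegVarTail (absTail P Y) α) (hp : α < p) (hp0 : 0 < p) :
    ∃ K : ℝ, 0 < K ∧ ∃ z₀ : ℝ, 0 < z₀ ∧ ∀ u, z₀ ≤ u →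
      ∫⁻ ω, ENNReal.ofReal (min |Y ω| u ^ p) ∂P ≤ ENNReal.ofReal (K * u ^ p * absTail P Y u) := by
  obtain ⟨q, hq1, hq2⟩ := exists_between hp
  obtain ⟨z₀, hz₀, hd⟩ := hH.exists_le_doubling hq1
  have h2 : (2 : ℝ) ^ q < 2 ^ p := Real.rpow_lt_rpow_of_exponent_lt (by norm_num) hq2
  have hHpos := hH.pos (2 * z₀)
  set K := max (1 / absTail P Y (2 * z₀)) (2 ^ p * 2 ^ q / (2 ^ p - 2 ^ q)) with hK
  have hK1 : 1 ≤ K * absTail P Y (2 * z₀) := by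
    rw [← div_le_iff₀ hHpos]; exact le_max_left _ _
  have hK2 : 2 ^ p * 2 ^ q ≤ K * (2 ^ p - 2 ^ q) := by
    rw [← div_le_iff₀ (by linarith)]; exact le_max_right _ _
  have hKpos : 0 < K := lt_max_of_lt_left (by positivity)
  refine ⟨K, hKpos, z₀, hz₀, ?_⟩
  have base : ∀ u, z₀ ≤ u → u ≤ 2 * z₀ →
      ∫⁻ ω, ENNReal.ofReal (min |Y ω| u ^ p) ∂P ≤ ENNReal.ofReal (K * u ^ p * absTail P Y u) := by
    intro u hu1 hu2
    have hu : 0 < u := hz₀.trans_le hu1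
    calc ∫⁻ ω, ENNReal.ofReal (min |Y ω| u ^ p) ∂P ≤ ∫⁻ _, ENNReal.ofReal (u ^ p) ∂P := by
          refine lintegral_mono fun ω => ENNReal.ofReal_le_ofReal ?_
          exact Real.rpow_le_rpow (le_min (abs_nonneg _) hu.le) (min_le_right _ _) hp0.le
      _ = ENNReal.ofReal (u ^ p) := by simp
      _ ≤ _ := by
          refine ENNReal.ofReal_le_ofReal ?_
          have h3 : K * absTail P Y (2 * z₀) ≤ K * absTail P Y u := by
            gcongr; exact hH.anti hu2
          have h4 : 0 < u ^ p := by positivity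
          nlinarith
  have step : ∀ u, z₀ ≤ u →
      ∫⁻ ω, ENNReal.ofReal (min |Y ω| u ^ p) ∂P ≤ ENNReal.ofReal (K * u ^ p * absTail P Y u) →
      ∫⁻ ω, ENNReal.ofReal (min |Y ω| (2 * u) ^ p) ∂P ≤
        ENNReal.ofReal (K * (2 * u) ^ p * absTail P Y (2 * u)) := by
    intro u hu1 ih
    have hu : 0 < u := hz₀.trans_le hu1
    have hms : MeasurableSet {ω | u < |Y ω|} := measurableSet_lt measurable_const hY.abs
    calc ∫⁻ ω, ENNReal.ofReal (min |Y ω| (2 * u) ^ p) ∂P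
        ≤ ∫⁻ ω, (ENNReal.ofReal (min |Y ω| u ^ p) +
            {ω | u < |Y ω|}.indicator (fun _ => ENNReal.ofReal ((2 * u) ^ p)) ω) ∂P := by
          refine lintegral_mono fun ω => ?_
          by_cases hω : u < |Y ω|
          · rw [Set.indicator_of_mem (by exact hω)]
            refine le_trans (ENNReal.ofReal_le_ofReal ?_) le_add_self
            exact Real.rpow_le_rpow (le_min (abs_nonneg _) (by linarith)) (min_le_right _ _) hp0.le
          · rw [min_eq_left (by linarith), min_eq_left (by linarith)]
            exact le_self_add
      _ = ∫⁻ ω, ENNReal.ofReal (min |Y ω| u ^ p) ∂P +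
            ENNReal.ofReal ((2 * u) ^ p) * P {ω | u < |Y ω|} := by
          rw [lintegral_add_right _ (measurable_const.indicator hms),
            lintegral_indicator_const hms]
      _ ≤ ENNReal.ofReal (K * u ^ p * absTail P Y u) +
            ENNReal.ofReal ((2 * u) ^ p) * ENNReal.ofReal (absTail P Y u) := by
          rw [ofReal_absTail]; gcongr
      _ = ENNReal.ofReal (u ^ p * (K + 2 ^ p) * absTail P Y u) := by
          have := absTail_nonneg (P := P) Y u
          rw [← ENNReal.ofReal_mul (by positivity), ← ENNReal.ofReal_add (by positivity)
            (by positivity), Real.mul_rpow two_pos.le hu.le]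
          ring_nf
      _ ≤ _ := by
          refine ENNReal.ofReal_le_ofReal ?_
          have h5 := hd u hu1
          have h6 := absTail_nonneg (P := P) Y (2 * u)
          have h7 : 0 < u ^ p := by positivity
          calc u ^ p * (K + 2 ^ p) * absTail P Y u
              ≤ u ^ p * (K + 2 ^ p) * (2 ^ q * absTail P Y (2 * u)) := by gcongr
            _ = u ^ p * absTail P Y (2 * u) * (2 ^ q * K + 2 ^ p * 2 ^ q) := by ring
            _ ≤ u ^ p * absTail P Y (2 * u) * (K * 2 ^ p) := by gcongr; linarith
            _ = _ := by rw [Real.mul_rpow two_pos.le hu.le]; ring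
  have all : ∀ n : ℕ, ∀ u, z₀ ≤ u → u ≤ 2 ^ n * (2 * z₀) →
      ∫⁻ ω, ENNReal.ofReal (min |Y ω| u ^ p) ∂P ≤ ENNReal.ofReal (K * u ^ p * absTail P Y u) := by
    intro n
    induction n with
    | zero => intro u h1 h2; exact base u h1 (by simpa using h2)
    | succ n ih =>
      intro u h1 h2
      rcases le_total u (2 * z₀) with h3 | h3
      · exact base u h1 h3
      · have := step (u / 2) (by linarith) (ih (u / 2) (by linarith) (by rw [pow_succ] at h2; linarith))
        rwa [mul_div_cancel₀ _ two_ne_zero] at this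
  intro u hu
  obtain ⟨n, hn⟩ := pow_unbounded_of_one_lt (u / (2 * z₀)) one_lt_two
  exact all n u hu ((div_lt_iff₀ (by positivity)).1 hn).le

end Tail

section Innovations

variable {Ω : Type*} [MeasurableSpace Ω] {P : Measure Ω} [IsProbabilityMeasure P]
  {γ π₁ π₂ : ℝ} {L : ℝ → ℝ} {c : ℕ → ℝ} {Z X : ℤ → Ω → ℝ}

lemma SlowlyVarying.tendsto_rpow_mul (hL : SlowlyVarying L) (a : ℝ) {y : ℝ} (hy : 0 < y) :
    Tendsto (fun z => ((y * z) ^ a * L (y * z)) / (z ^ a * L z)) atTop (𝓝 (y ^ a)) := by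
  have h := (hL y hy).const_mul (y ^ a)
  rw [mul_one] at h
  refine h.congr' ?_
  filter_upwards [eventually_gt_atTop 0] with z hz
  have : 0 < z ^ a := by positivity
  rw [Real.mul_rpow hy.le hz.le]
  field_simp

lemma BasicAssumptions.regVarTail_innov (hA : BasicAssumptions P γ π₁ π₂ L c Z X) :
    RegVarTail (absTail P (Z 0)) (1 / γ) := by
  have hZ := hA.innov_measurable 0
  have hneg : (-1 / γ : ℝ) = -(1 / γ) := by ring
  have hγ := hA.gamma_pos
  set D : ℝ → ℝ := fun z => z ^ (-1 / γ) * L z with hD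
  have hDlim : ∀ y : ℝ, 0 < y → Tendsto (fun z => D (y * z) / D z) atTop (𝓝 (y ^ (-(1 / γ)))) :=
    fun y hy => by rw [← hneg]; exact hA.slowly_varying.tendsto_rpow_mul _ hy
  set Q : ℝ → ℝ := fun z => P.real {ω | z < Z 0 ω} + P.real {ω | Z 0 ω ≤ -z} with hQ
  have hQlim : Tendsto (fun z => Q z / D z) atTop (𝓝 1) := by
    have h := hA.right_tail.add hA.left_tail
    rw [hA.pi_add] at h
    refine h.congr fun z => ?_
    rw [← add_div]
    congr 2
    rw [← probReal_compl_eq_one_sub (measurableSet_le hZ measurable_const)]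
    congr 1
    ext ω; simp
  have hup : ∀ z, absTail P (Z 0) z ≤ Q z := fun z => by
    refine (measureReal_mono (fun ω (hω : z < |Z 0 ω|) => ?_)).trans (measureReal_union_le _ _)
    rcases lt_abs.1 hω with h | h
    · exact Or.inl h
    · exact Or.inr (show Z 0 ω ≤ -z by linarith)
  have hlow : ∀ y, 1 < y → ∀ z, 0 < z → Q (y * z) ≤ absTail P (Z 0) z := fun y hy z hz => by
    have hyz : z < y * z := by nlinarith
    simp only [hQ]
    rw [← measureReal_union _ (measurableSet_le hZ measurable_const)]
    · refine measureReal_mono ?_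
      rintro ω (hω | hω)
      · exact lt_abs.2 (Or.inl (hyz.trans hω))
      · exact lt_abs.2 (Or.inr (by
          have : y * z ≤ -Z 0 ω := le_neg_of_le_neg hω
          exact hyz.trans_le this))
    · refine Set.disjoint_left.2 fun ω (h1 : y * z < Z 0 ω) (h2 : Z 0 ω ≤ -(y * z)) => ?_
      linarith
  have hDpos : ∀ᶠ z in atTop, 0 < D z := by
    filter_upwards [hQlim.eventually (lt_mem_nhds one_pos)] with z hz
    have hQ0 : 0 ≤ Q z := by positivity
    by_contra hneg
    exact absurd hz (not_lt.2 (div_nonpos_of_nonneg_of_nonpos hQ0 (not_lt.1 hneg)))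
  have hlim : Tendsto (fun z => absTail P (Z 0) z / D z) atTop (𝓝 1) := by
    refine tendsto_order.2 ⟨fun a ha => ?_, fun a ha => ?_⟩
    · have hcont : ContinuousAt (fun y : ℝ => y ^ (-(1 / γ))) 1 :=
        Real.continuousAt_rpow_const _ _ (Or.inl one_ne_zero)
      have h1 : ∀ᶠ y in 𝓝[>] (1 : ℝ), a < y ^ (-(1 / γ)) :=
        nhdsWithin_le_nhds (hcont.eventually (lt_mem_nhds (by simpa using ha)))
      obtain ⟨y, hy1, hy2⟩ := (h1.and self_mem_nhdsWithin).exists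
      have hy0 : (0 : ℝ) < y := one_pos.trans hy2
      have hyt : Tendsto (fun z : ℝ => y * z) atTop atTop := tendsto_id.const_mul_atTop hy0
      have h2 := (hQlim.comp hyt).mul (hDlim y hy0)
      rw [one_mul] at h2
      filter_upwards [h2.eventually (lt_mem_nhds hy1), hDpos, hyt.eventually hDpos,
        eventually_gt_atTop 0] with z hz hD1 hD2 hz0
      refine hz.trans_le ?_
      simp only [Function.comp_apply]
      rw [div_mul_div_cancel₀ hD2.ne']
      gcongr
      exact hlow y hy2 z hz0
    · filter_upwards [hQlim.eventually (gt_mem_nhds ha), hDpos] with z hz hD1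
      refine lt_of_le_of_lt ?_ hz
      gcongr
      exact hup z
  exact RegVarTail.of_tendsto_div (absTail_antitone _) (absTail_nonneg _) one_pos hlim hDlim

lemma one_le_tsum_mul_rpow {w f : ℕ → ℝ≥0∞} (hw : ∑' j, w j ≤ 1) {p : ℝ} (hp : 1 ≤ p)
    (h : 1 ≤ ∑' j, w j * f j) : 1 ≤ ∑' j, w j * f j ^ p := by
  have hp0 : 0 < p := by linarith
  have h1 : ∑' j, w j * f j ≤ (∑' j, w j * f j ^ p) ^ p⁻¹ := by
    rw [ENNReal.tsum_eq_iSup_sum]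
    refine iSup_le fun s => (ENNReal.inner_le_weight_mul_Lp_of_nonneg s hp w f).trans ?_
    have h2 : (∑ i ∈ s, w i) ^ (1 - p⁻¹) ≤ 1 :=
      ENNReal.rpow_le_one ((ENNReal.sum_le_tsum s).trans hw)
        (sub_nonneg.2 (inv_le_one_of_one_le₀ hp))
    calc _ ≤ 1 * (∑' j, w j * f j ^ p) ^ p⁻¹ := by
          gcongr
          exact ENNReal.sum_le_tsum s
      _ = _ := one_mul _
  have h3 := h.trans h1
  by_contra hlt
  exact absurd h3 (not_le.2 (ENNReal.rpow_lt_one (not_le.1 hlt) (by positivity)))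

lemma one_le_tsum_min_one {x : ℕ → ℝ} {s : ℝ} (hx : HasSum x s) (hs : 1 < |s|) :
    1 ≤ ∑' j, ENNReal.ofReal (min |x j| 1) := by
  by_cases h : ∃ j, 1 ≤ |x j|
  · obtain ⟨j, hj⟩ := h
    refine le_trans ?_ (ENNReal.le_tsum j)
    simp [hj]
  · push Not at h
    have h1 : ∀ j, ENNReal.ofReal (min |x j| 1) = ENNReal.ofReal |x j| := fun j => by
      rw [min_eq_left (h j).le]
    simp_rw [h1]
    have hsum : Summable fun j => |x j| := hx.summable.abs
    rw [← ENNReal.ofReal_tsum_of_nonneg (fun _ => abs_nonneg _) hsum, ENNReal.one_le_ofReal]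
    refine hs.le.trans ?_
    rw [← hx.tsum_eq]
    simpa [Real.norm_eq_abs] using norm_tsum_le_tsum_norm (f := x) (by simpa using hsum)

/-- The finite moving average `∑_{j < m} c_j Z_{n-j}`. -/
noncomputable def movingAverage (c : ℕ → ℝ) (Z : ℤ → Ω → ℝ) (m : ℕ) (n : ℤ) (ω : Ω) : ℝ :=
  ∑ j ∈ Finset.range m, c j * Z (n - (j : ℤ)) ω

lemma lintegral_weighted_min_le {Y Y₀ : Ω → ℝ} (hid : IdentDistrib Y Y₀ P P) {δ p K z₀ a z : ℝ}
    (hδ : 0 < δ) (hp : 1 ≤ p) (hK0 : 0 < K) (hz₀ : 0 < z₀)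
    (hK : ∀ u, z₀ ≤ u → ∫⁻ ω, ENNReal.ofReal (min |Y₀ ω| u ^ p) ∂P ≤
      ENNReal.ofReal (K * u ^ p * absTail P Y₀ u))
    (hpot : ∀ z, z₀ ≤ z → ∀ y, 1 ≤ y →
      absTail P Y₀ (y * z) ≤ 2 ^ (δ * p) * y ^ (-(δ * p)) * absTail P Y₀ z)
    (ha : |a| ≤ 1) (hz : z₀ ≤ z) :
    ∫⁻ ω, ENNReal.ofReal (|a| ^ δ) * ENNReal.ofReal (min |a * Y ω / z| 1 / |a| ^ δ) ^ p ∂P ≤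
      ENNReal.ofReal (K * 2 ^ (δ * p) * absTail P Y₀ z * |a| ^ δ) := by
  have hz0 : 0 < z := hz₀.trans_le hz
  have hp0 : 0 < p := by linarith
  rcases eq_or_ne a 0 with rfl | ha0
  · simp [Real.zero_rpow hδ.ne']
  have hb : 0 < |a| := abs_pos.2 ha0
  set b := |a| with hbdef
  have hmin : ∀ y : ℝ, min |a * y / z| 1 = b / z * min |y| (z / b) := fun y => by
    rw [mul_min_of_nonneg _ _ (by positivity), abs_div, abs_mul, abs_of_pos hz0]
    congr 1
    · rw [← hbdef]; ring
    · field_simp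
  have hu : z₀ ≤ z / b := hz.trans ((le_div_iff₀ hb).2 (by nlinarith))
  have hmono : ∀ y : ℝ, ENNReal.ofReal (b ^ δ) * ENNReal.ofReal (min |a * y / z| 1 / b ^ δ) ^ p =
      ENNReal.ofReal (b ^ δ * (b / z / b ^ δ) ^ p) * ENNReal.ofReal (min |y| (z / b) ^ p) := by
    intro y
    have h0 : 0 ≤ min |y| (z / b) := le_min (abs_nonneg _) (by positivity)
    rw [hmin, ENNReal.ofReal_rpow_of_nonneg (by positivity) hp0.le,
      ← ENNReal.ofReal_mul (by positivity), ← ENNReal.ofReal_mul (by positivity)]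
    congr 1
    rw [mul_assoc, ← Real.mul_rpow (by positivity) h0]
    ring_nf
  have hmeas : Measurable fun y : ℝ => ENNReal.ofReal (min |y| (z / b) ^ p) := by fun_prop
  simp_rw [hmono]
  have hint := (hid.comp hmeas).lintegral_eq
  simp only [Function.comp_def] at hint
  rw [lintegral_const_mul' _ _ ENNReal.ofReal_ne_top, hint]
  refine (mul_le_mul_right (hK _ hu) _).trans ?_
  rw [← ENNReal.ofReal_mul (by positivity)]
  refine ENNReal.ofReal_le_ofReal ?_
  have h1 : absTail P Y₀ (z / b) ≤ 2 ^ (δ * p) * b ^ (δ * p) * absTail P Y₀ z := by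
    have h := hpot z hz b⁻¹ ((one_le_inv₀ hb).2 ha)
    rwa [inv_mul_eq_div, Real.rpow_neg (by positivity), Real.inv_rpow hb.le, inv_inv] at h
  have h2 : (b / z / b ^ δ) ^ p * (z / b) ^ p * b ^ (δ * p) = 1 := by
    rw [Real.rpow_mul hb.le, ← Real.mul_rpow (by positivity) (by positivity),
      ← Real.mul_rpow (by positivity) (by positivity)]
    have : b / z / b ^ δ * (z / b) * b ^ δ = 1 := by
      have : 0 < b ^ δ := by positivity
      field_simp
    rw [this, Real.one_rpow]
  calc b ^ δ * (b / z / b ^ δ) ^ p * (K * (z / b) ^ p * absTail P Y₀ (z / b))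
      ≤ b ^ δ * (b / z / b ^ δ) ^ p *
          (K * (z / b) ^ p * (2 ^ (δ * p) * b ^ (δ * p) * absTail P Y₀ z)) := by gcongr
    _ = ((b / z / b ^ δ) ^ p * (z / b) ^ p * b ^ (δ * p)) *
          (K * 2 ^ (δ * p) * absTail P Y₀ z * b ^ δ) := by ring
    _ = _ := by rw [h2, one_mul]

/-- The tail of `X_n - ∑_{j < m} c_j Z_{n-j}` is a small multiple of the tail of `Z_0`,
uniformly in `n`. -/
lemma BasicAssumptions.absTail_remainder_le (hA : BasicAssumptions P γ π₁ π₂ L c Z X) :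
    ∃ σ : ℕ → ℝ, Tendsto σ atTop (𝓝 0) ∧ (∀ m, 0 ≤ σ m) ∧ ∃ z₀ : ℝ, ∃ m₀ : ℕ, ∀ m, m₀ ≤ m →
      ∀ z, z₀ ≤ z → ∀ n, absTail P (fun ω => X n ω - movingAverage c Z m n ω) z ≤
        σ m * absTail P (Z 0) z := by
  obtain ⟨δ, hδ0, hδ, hsum⟩ := hA.coeff_summable
  have hγ := hA.gamma_pos
  have hα : 0 < 1 / γ := by positivity
  have hδ1 : δ < 1 := hδ.trans_le (min_le_right _ _)
  have hδα : δ < 1 / γ := hδ.trans_le (min_le_left _ _)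
  have hpex : max 1 (1 / γ) < 1 / γ / δ := by
    rw [lt_div_iff₀ hδ0]
    rcases le_total 1 (1 / γ) with h | h
    · rw [max_eq_right h]; nlinarith
    · rw [max_eq_left h]; linarith
  obtain ⟨p, hp1, hp2⟩ := exists_between hpex
  have hp : 1 ≤ p := ((le_max_left _ _).trans_lt hp1).le
  have hp0 : 0 < p := by linarith
  have hβ : δ * p < 1 / γ := by rw [lt_div_iff₀ hδ0] at hp2; linarith
  have hH := hA.regVarTail_innov
  obtain ⟨K, hK0, z₁, hz₁, hK⟩ := lintegral_min_rpow_le (hA.innov_measurable 0) hH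
    ((le_max_right _ _).trans_lt hp1) hp0
  obtain ⟨z₂, hz₂, hpot⟩ := hH.potter (by positivity : 0 ≤ δ * p) hβ
  have htail : Tendsto (fun m => ∑' j, |c (j + m)| ^ δ) atTop (𝓝 0) :=
    tendsto_sum_nat_add fun j => |c j| ^ δ
  have hc : ∀ᶠ m in atTop, |c m| ≤ 1 := by
    filter_upwards [hsum.tendsto_atTop_zero.eventually (gt_mem_nhds one_pos)] with m hm
    by_contra h1
    exact absurd hm (not_lt.2 (Real.one_le_rpow (not_le.1 h1).le hδ0.le))
  obtain ⟨m₁, hm₁⟩ := eventually_atTop.1 hc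
  obtain ⟨m₂, hm₂⟩ := eventually_atTop.1 (htail.eventually (gt_mem_nhds one_pos))
  refine ⟨fun m => K * 2 ^ (δ * p) * ∑' j, |c (j + m)| ^ δ, by simpa using htail.const_mul _,
    fun m => mul_nonneg (by positivity) (tsum_nonneg fun j => by positivity),
    max z₁ z₂, max m₁ m₂, fun m hm z hz n => ?_⟩
  have hz0 : 0 < z := (hz₁.trans_le (le_max_left _ _)).trans_le hz
  have hsum' : Summable fun j => |c (j + m)| ^ δ :=
    (summable_nat_add_iff (f := fun j => |c j| ^ δ) m).2 hsum
  set w : ℕ → ℝ≥0∞ := fun j => ENNReal.ofReal (|c (j + m)| ^ δ) with hw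
  set f : ℕ → Ω → ℝ≥0∞ := fun j ω =>
    ENNReal.ofReal (min |c (j + m) * Z (n - ((j + m : ℕ) : ℤ)) ω / z| 1 / |c (j + m)| ^ δ) with hf
  have hwf : ∀ j ω, w j * f j ω =
      ENNReal.ofReal (min |c (j + m) * Z (n - ((j + m : ℕ) : ℤ)) ω / z| 1) := fun j ω => by
    rw [hw, hf, ← ENNReal.ofReal_mul (by positivity)]
    rcases eq_or_ne (c (j + m)) 0 with h0 | h0
    · simp [h0]
    · have : 0 < |c (j + m)| ^ δ := by positivity
      rw [mul_div_cancel₀ _ this.ne']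
  have hw1 : ∑' j, w j ≤ 1 := by
    rw [← ENNReal.ofReal_tsum_of_nonneg (fun _ => by positivity) hsum', ENNReal.ofReal_le_one]
    exact (hm₂ m ((le_max_right _ _).trans hm)).le
  have hfm : ∀ j, Measurable fun ω => w j * f j ω ^ p := fun j => by
    have := hA.innov_measurable (n - ((j + m : ℕ) : ℤ))
    simp only [hf]
    fun_prop
  have hae : ∀ᵐ ω ∂P, ω ∈ {ω | z < |X n ω - movingAverage c Z m n ω|} →
      ω ∈ {ω | 1 ≤ ∑' j, w j * f j ω ^ p} := by
    filter_upwards [hA.linear n] with ω hω hωz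
    refine one_le_tsum_mul_rpow hw1 hp ?_
    simp_rw [hwf]
    have h1 : HasSum (fun j => c (j + m) * Z (n - ((j + m : ℕ) : ℤ)) ω)
        (X n ω - movingAverage c Z m n ω) :=
      (hasSum_nat_add_iff' (f := fun j : ℕ => c j * Z (n - (j : ℤ)) ω) m).2 hω
    refine one_le_tsum_min_one (h1.div_const z) ?_
    rw [abs_div, abs_of_pos hz0, lt_div_iff₀ hz0, one_mul]
    exact hωz
  have hle : ENNReal.ofReal (absTail P (fun ω => X n ω - movingAverage c Z m n ω) z) ≤
      ENNReal.ofReal (K * 2 ^ (δ * p) * (∑' j, |c (j + m)| ^ δ) * absTail P (Z 0) z) := by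
    rw [ofReal_absTail]
    calc P {ω | z < |X n ω - movingAverage c Z m n ω|}
        ≤ P {ω | 1 ≤ ∑' j, w j * f j ω ^ p} := measure_mono_ae hae
      _ ≤ ∫⁻ ω, ∑' j, w j * f j ω ^ p ∂P := by
          simpa using mul_meas_ge_le_lintegral (μ := P) (Measurable.tsum hfm) 1
      _ = ∑' j, ∫⁻ ω, w j * f j ω ^ p ∂P := lintegral_tsum fun j => (hfm j).aemeasurable
      _ ≤ ∑' j, ENNReal.ofReal (K * 2 ^ (δ * p) * absTail P (Z 0) z * |c (j + m)| ^ δ) := by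
          refine ENNReal.tsum_le_tsum fun j => ?_
          exact lintegral_weighted_min_le (hA.innov_identDistrib _) hδ0 hp hK0
            (hz₁.trans_le (le_max_left z₁ z₂)) (fun u hu => hK u ((le_max_left _ _).trans hu))
            (fun u hu => hpot u ((le_max_right _ _).trans hu))
            (hm₁ _ (((le_max_left _ _).trans hm).trans (Nat.le_add_left _ _))) hz
      _ = _ := by
          have := (hH.pos z).le
          rw [← ENNReal.ofReal_tsum_of_nonneg (fun _ => by positivity) (hsum'.mul_left _),
            tsum_mul_left]
          congr 1; ring
  have h0 := (hH.pos z).le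
  exact (ENNReal.ofReal_le_ofReal_iff (mul_nonneg (mul_nonneg (by positivity)
    (tsum_nonneg fun j => by positivity)) h0)).1 hle

end Innovations

section Tail

lemma exists_mul_one_sub_rpow_lt (α : ℝ) {s a : ℝ} (h : s < a) :
    ∃ ε : ℝ, 0 < ε ∧ ε < 1 ∧ s * (1 - ε) ^ (-α) < a := by
  have hc : ContinuousAt (fun ε : ℝ => s * (1 - ε) ^ (-α)) 0 :=
    continuousAt_const.mul ((continuousAt_const.sub continuousAt_id).rpow_const
      (Or.inl (by norm_num)))
  have h1 : ∀ᶠ ε in 𝓝[>] (0 : ℝ), s * (1 - ε) ^ (-α) < a :=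
    nhdsWithin_le_nhds (hc.eventually (gt_mem_nhds (by simpa using h)))
  obtain ⟨ε, ⟨h2, h3⟩, h4⟩ := ((h1.and (nhdsWithin_le_nhds (gt_mem_nhds one_pos))).and
    self_mem_nhdsWithin).exists
  exact ⟨ε, h4, h3, h2⟩

lemma exists_lt_mul_one_add_rpow (α : ℝ) {s a : ℝ} (h : a < s) :
    ∃ ε : ℝ, 0 < ε ∧ ε < 1 ∧ a < s * (1 + ε) ^ (-α) := by
  have hc : ContinuousAt (fun ε : ℝ => s * (1 + ε) ^ (-α)) 0 :=
    continuousAt_const.mul ((continuousAt_const.add continuousAt_id).rpow_const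
      (Or.inl (by norm_num)))
  have h1 : ∀ᶠ ε in 𝓝[>] (0 : ℝ), a < s * (1 + ε) ^ (-α) :=
    nhdsWithin_le_nhds (hc.eventually (lt_mem_nhds (by simpa using h)))
  obtain ⟨ε, ⟨h2, h3⟩, h4⟩ := ((h1.and (nhdsWithin_le_nhds (gt_mem_nhds one_pos))).and
    self_mem_nhdsWithin).exists
  exact ⟨ε, h4, h3, h2⟩

variable {H : ℝ → ℝ} {α : ℝ}

lemma RegVarTail.tendsto_zero (hH : RegVarTail H α) (hα : 0 < α) : Tendsto H atTop (𝓝 0) := by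
  obtain ⟨z₀, hz₀, h⟩ := hH.potter (β := α / 2) (by positivity) (by linarith)
  have h1 : Tendsto (fun y : ℝ => 2 ^ (α / 2) * y ^ (-(α / 2)) * H z₀) atTop (𝓝 0) := by
    simpa using ((tendsto_rpow_neg_atTop (y := α / 2) (by positivity)).const_mul
      ((2 : ℝ) ^ (α / 2))).mul_const (H z₀)
  have h2 : Tendsto (fun y : ℝ => H (y * z₀)) atTop (𝓝 0) :=
    squeeze_zero' (Eventually.of_forall fun y => (hH.pos _).le)
      ((eventually_ge_atTop 1).mono fun y hy => h z₀ le_rfl y hy) h1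
  refine (h2.comp (tendsto_id.atTop_div_const hz₀)).congr fun z => ?_
  simp [hz₀.ne']

lemma RegVarTail.tendsto_mul_div (hH : RegVarTail H α) {F : ℝ → ℝ} {a : ℝ}
    (hF : Tendsto (fun z => F z / H z) atTop (𝓝 a)) {y : ℝ} (hy : 0 < y) :
    Tendsto (fun z => F (y * z) / H z) atTop (𝓝 (a * y ^ (-α))) := by
  refine ((hF.comp (tendsto_id.const_mul_atTop hy)).mul (hH.ratio y hy)).congr fun z => ?_
  have := (hH.pos (y * z)).ne'
  simp only [Function.comp_apply, id_eq]
  exact div_mul_div_cancel₀ this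

variable {Ω : Type*} [MeasurableSpace Ω] {P : Measure Ω}

lemma absTail_congr_identDistrib {Y Y' : Ω → ℝ} (h : IdentDistrib Y Y' P P) :
    absTail P Y = absTail P Y' := by
  funext z
  have hs : MeasurableSet {x : ℝ | z < |x|} := measurableSet_lt measurable_const measurable_id.abs
  exact congrArg ENNReal.toReal (h.measure_mem_eq hs)

lemma tendsto_absTail_const_mul (hα : 0 < α) {Y : Ω → ℝ} (hH : RegVarTail (absTail P Y) α)
    (a : ℝ) :
    Tendsto (fun z => absTail P (fun ω => a * Y ω) z / absTail P Y z) atTop (𝓝 (|a| ^ α)) := by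
  rcases eq_or_ne a 0 with rfl | ha
  · rw [abs_zero, Real.zero_rpow hα.ne']
    refine tendsto_const_nhds.congr' ?_
    filter_upwards [eventually_ge_atTop 0] with z hz
    have : absTail P (fun ω => 0 * Y ω) z = 0 := by simp [absTail, not_lt.2 hz]
    rw [this, zero_div]
  · have hb : 0 < |a| := abs_pos.2 ha
    have h := hH.ratio |a|⁻¹ (by positivity)
    rw [Real.inv_rpow hb.le, Real.rpow_neg hb.le, inv_inv] at h
    refine h.congr fun z => ?_
    have : ∀ ω, |a|⁻¹ * z < |Y ω| ↔ z < |a * Y ω| := fun ω => by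
      rw [abs_mul, inv_mul_lt_iff₀ hb]
    simp only [absTail, this]

variable {γ π₁ π₂ : ℝ} {L : ℝ → ℝ} {c : ℕ → ℝ} {Z X : ℤ → Ω → ℝ}

lemma BasicAssumptions.summable_rpow (hA : BasicAssumptions P γ π₁ π₂ L c Z X) :
    Summable fun j => |c j| ^ (1 / γ) := by
  obtain ⟨δ, hδ0, hδ, hsum⟩ := hA.coeff_summable
  have hδα : δ < 1 / γ := hδ.trans_le (min_le_left _ _)
  refine summable_of_isBigO_nat hsum (Asymptotics.IsBigO.of_bound 1 ?_)
  filter_upwards [hsum.tendsto_atTop_zero.eventually (gt_mem_nhds one_pos)] with j hj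
  have h1 : |c j| ≤ 1 := by
    by_contra h1
    exact absurd hj (not_lt.2 (Real.one_le_rpow (not_le.1 h1).le hδ0.le))
  rw [Real.norm_of_nonneg (by positivity), Real.norm_of_nonneg (by positivity), one_mul]
  exact Real.rpow_le_rpow_of_exponent_ge_of_imp (abs_nonneg _) h1 hδα.le
    (fun _ h => absurd h (hδ0.trans hδα).ne')

variable [IsProbabilityMeasure P]

/-- The principle of a single big jump: the tail of a sum of two independent variables
is asymptotic to the sum of the tails. -/
lemma tendsto_absTail_add_div (hα : 0 < α) (hH : RegVarTail H α) {A B : Ω → ℝ}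
    (hA : Measurable A) (hB : Measurable B) (hind : IndepFun A B P) {a b : ℝ}
    (ha : Tendsto (fun z => absTail P A z / H z) atTop (𝓝 a))
    (hb : Tendsto (fun z => absTail P B z / H z) atTop (𝓝 b)) :
    Tendsto (fun z => absTail P (fun ω => A ω + B ω) z / H z) atTop (𝓝 (a + b)) := by
  have hzero : ∀ {Y : Ω → ℝ} {s : ℝ}, Tendsto (fun z => absTail P Y z / H z) atTop (𝓝 s) →
      ∀ y : ℝ, 0 < y → Tendsto (fun z => absTail P Y (y * z)) atTop (𝓝 0) := by
    intro Y s h y hy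
    have h1 := h.mul (hH.tendsto_zero hα)
    rw [mul_zero] at h1
    have h2 : Tendsto (absTail P Y) atTop (𝓝 0) :=
      h1.congr fun z => div_mul_cancel₀ _ (hH.pos z).ne'
    exact h2.comp (tendsto_id.const_mul_atTop hy)
  have hmA : ∀ u, MeasurableSet {ω | u < |A ω|} := fun u => measurableSet_lt measurable_const hA.abs
  have hmB : ∀ u, MeasurableSet {ω | u < |B ω|} := fun u => measurableSet_lt measurable_const hB.abs
  have hinter : ∀ u v, P.real ({ω | u < |A ω|} ∩ {ω | v < |B ω|}) =
      absTail P A u * absTail P B v := fun u v => by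
    have hs : ∀ u : ℝ, MeasurableSet {x : ℝ | u < |x|} := fun u =>
      measurableSet_lt measurable_const measurable_id.abs
    have h := hind.measure_inter_preimage_eq_mul _ _ (hs u) (hs v)
    simpa [absTail, Measure.real] using congrArg ENNReal.toReal h
  refine tendsto_order.2 ⟨fun r hr => ?_, fun r hr => ?_⟩
  · obtain ⟨ε, hε0, hε1, hε⟩ := exists_lt_mul_one_add_rpow α hr
    have hlow : ∀ z, 0 < z → absTail P A ((1 + ε) * z) * (1 - absTail P B (ε * z)) +
        absTail P B ((1 + ε) * z) * (1 - absTail P A (ε * z)) ≤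
          absTail P (fun ω => A ω + B ω) z := by
      intro z hz
      have hεz : ε * z < (1 + ε) * z := by nlinarith
      have e1 : P.real ({ω | (1 + ε) * z < |A ω|} \ {ω | ε * z < |B ω|}) =
          absTail P A ((1 + ε) * z) * (1 - absTail P B (ε * z)) := by
        rw [← Set.sdiff_inter_self_eq_sdiff, measureReal_sdiff Set.inter_subset_right
          ((hmB _).inter (hmA _)), Set.inter_comm, hinter, absTail]
        ring
      have e2 : P.real ({ω | (1 + ε) * z < |B ω|} \ {ω | ε * z < |A ω|}) =
          absTail P B ((1 + ε) * z) * (1 - absTail P A (ε * z)) := by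
        rw [← Set.sdiff_inter_self_eq_sdiff, measureReal_sdiff Set.inter_subset_right
          ((hmA _).inter (hmB _)), hinter, absTail]
        simp only [absTail]
        ring
      rw [← e1, ← e2, ← measureReal_union _ ((hmB _).diff (hmA _))]
      · refine measureReal_mono ?_
        rintro ω (⟨h1, h2⟩ | ⟨h1, h2⟩)
        · simp only [Set.mem_ofPred_eq, not_lt] at h1 h2 ⊢
          have := abs_sub_abs_le_abs_sub (A ω) (-B ω)
          rw [abs_neg, sub_neg_eq_add] at this
          linarith
        · simp only [Set.mem_ofPred_eq, not_lt] at h1 h2 ⊢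
          have := abs_sub_abs_le_abs_sub (B ω) (-A ω)
          rw [abs_neg, sub_neg_eq_add, add_comm (B ω)] at this
          linarith
      · refine Set.disjoint_left.2 ?_
        rintro ω ⟨h1, -⟩ ⟨-, h2⟩
        exact h2 (hεz.trans h1)
    have hlim := ((hH.tendsto_mul_div ha (y := 1 + ε) (by linarith)).mul
      ((hzero hb ε hε0).const_sub 1)).add ((hH.tendsto_mul_div hb (y := 1 + ε) (by linarith)).mul
      ((hzero ha ε hε0).const_sub 1))
    rw [sub_zero, mul_one, mul_one, ← add_mul] at hlim
    filter_upwards [hlim.eventually (lt_mem_nhds hε), eventually_gt_atTop 0] with z hz hz0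
    refine hz.trans_le ?_
    rw [div_mul_eq_mul_div, div_mul_eq_mul_div, ← add_div]
    have := hH.pos z
    gcongr
    exact hlow z hz0
  · obtain ⟨ε, hε0, hε1, hε⟩ := exists_mul_one_sub_rpow_lt α hr
    have hup : ∀ z, absTail P (fun ω => A ω + B ω) z ≤ absTail P A ((1 - ε) * z) +
        absTail P B ((1 - ε) * z) + absTail P A (ε * z) * absTail P B (ε * z) := by
      intro z
      rw [← hinter]
      refine (measureReal_mono (s₂ := ({ω | (1 - ε) * z < |A ω|} ∪ {ω | (1 - ε) * z < |B ω|}) ∪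
        ({ω | ε * z < |A ω|} ∩ {ω | ε * z < |B ω|})) fun ω hω => ?_).trans
        ((measureReal_union_le _ _).trans (add_le_add_left (measureReal_union_le _ _) _))
      by_contra hcon
      simp only [Set.mem_union, Set.mem_inter_iff, Set.mem_ofPred_eq, not_or, not_and_or,
        not_lt] at hcon hω
      have := abs_add_le (A ω) (B ω)
      rcases hcon.2 with h | h <;> linarith [hcon.1.1, hcon.1.2]
    have hlim := ((hH.tendsto_mul_div ha (y := 1 - ε) (by linarith)).add
      (hH.tendsto_mul_div hb (y := 1 - ε) (by linarith))).add
      ((hH.tendsto_mul_div ha hε0).mul (hzero hb ε hε0))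
    rw [mul_zero, add_zero, ← add_mul] at hlim
    filter_upwards [hlim.eventually (gt_mem_nhds hε)] with z hz
    refine lt_of_le_of_lt ?_ hz
    rw [div_mul_eq_mul_div, ← add_div, ← add_div]
    have := hH.pos z
    gcongr
    exact hup z

/-- Perturbation by variables with uniformly small tails. -/
lemma tendsto_absTail_div_of_approx (hH : RegVarTail H α) {Y : Ω → ℝ} {V : ℕ → Ω → ℝ}
    {s : ℕ → ℝ} {S : ℝ} (hV : ∀ m, Tendsto (fun z => absTail P (V m) z / H z) atTop (𝓝 (s m)))
    (hs : Tendsto s atTop (𝓝 S)) {σ : ℕ → ℝ} (hσ : Tendsto σ atTop (𝓝 0))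
    (hrem : ∃ m₀ : ℕ, ∀ m, m₀ ≤ m → ∀ᶠ z in atTop,
      absTail P (fun ω => Y ω - V m ω) z ≤ σ m * H z) :
    Tendsto (fun z => absTail P Y z / H z) atTop (𝓝 S) := by
  obtain ⟨m₀, hm₀⟩ := hrem
  have hbd : ∀ {ε : ℝ}, 0 < ε → ∀ m, m₀ ≤ m → ∀ r, σ m * ε ^ (-α) < r → ∀ᶠ z in atTop,
      absTail P (fun ω => Y ω - V m ω) (ε * z) / H z < r := by
    intro ε hε m hm r hr
    have h1 := (hH.ratio ε hε).const_mul (σ m)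
    filter_upwards [h1.eventually (gt_mem_nhds hr),
      (tendsto_id.const_mul_atTop hε).eventually (hm₀ m hm)] with z hz1 hz2
    refine lt_of_le_of_lt ?_ hz1
    rw [← mul_div_assoc]
    have := hH.pos z
    gcongr
    exact hz2
  have hσε : ∀ {ε : ℝ}, Tendsto (fun m => σ m * ε ^ (-α)) atTop (𝓝 0) := fun {ε} => by
    simpa using hσ.mul_const (ε ^ (-α))
  refine tendsto_order.2 ⟨fun r hr => ?_, fun r hr => ?_⟩
  · obtain ⟨ε, hε0, -, hε⟩ := exists_lt_mul_one_add_rpow α hr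
    have h1 := (hs.mul_const ((1 + ε) ^ (-α))).sub (hσε (ε := ε))
    rw [sub_zero] at h1
    obtain ⟨m, hm1, hm2⟩ := ((h1.eventually (lt_mem_nhds hε)).and (eventually_ge_atTop m₀)).exists
    obtain ⟨r', hr1, hr2⟩ := exists_between (lt_sub_iff_add_lt.1 hm1 |> lt_sub_iff_add_lt'.2)
    have h2 := hH.tendsto_mul_div (hV m) (y := 1 + ε) (by linarith)
    filter_upwards [h2.eventually (lt_mem_nhds (lt_sub_iff_add_lt'.1 hr2)), hbd hε0 m hm2 r' hr1]
      with z hz1 hz2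
    have h3 : absTail P (V m) ((1 + ε) * z) ≤ absTail P Y z +
        absTail P (fun ω => Y ω - V m ω) (ε * z) := by
      refine (measureReal_mono fun ω hω => ?_).trans (measureReal_union_le _ _)
      by_contra hcon
      simp only [Set.mem_union, Set.mem_ofPred_eq, not_or, not_lt] at hcon hω
      have := abs_sub_abs_le_abs_sub (V m ω) (Y ω)
      rw [abs_sub_comm] at this
      linarith [hcon.1, hcon.2]
    have h4 : absTail P (V m) ((1 + ε) * z) / H z ≤ absTail P Y z / H z +
        absTail P (fun ω => Y ω - V m ω) (ε * z) / H z := by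
      rw [← add_div]
      have := hH.pos z
      gcongr
    linarith
  · obtain ⟨ε, hε0, hε1, hε⟩ := exists_mul_one_sub_rpow_lt α hr
    have h1 := (hs.mul_const ((1 - ε) ^ (-α))).add (hσε (ε := ε))
    rw [add_zero] at h1
    obtain ⟨m, hm1, hm2⟩ := ((h1.eventually (gt_mem_nhds hε)).and (eventually_ge_atTop m₀)).exists
    obtain ⟨r', hr1, hr2⟩ := exists_between (lt_sub_iff_add_lt'.2 hm1)
    have h2 := hH.tendsto_mul_div (hV m) (y := 1 - ε) (by linarith)
    filter_upwards [h2.eventually (gt_mem_nhds (lt_sub_iff_add_lt.2 (lt_sub_iff_add_lt'.1 hr2))),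
      hbd hε0 m hm2 r' hr1] with z hz1 hz2
    have h3 : absTail P Y z ≤ absTail P (V m) ((1 - ε) * z) +
        absTail P (fun ω => Y ω - V m ω) (ε * z) := by
      refine (measureReal_mono fun ω hω => ?_).trans (measureReal_union_le _ _)
      by_contra hcon
      simp only [Set.mem_union, Set.mem_ofPred_eq, not_or, not_lt] at hcon hω
      have := abs_sub_abs_le_abs_sub (Y ω) (V m ω)
      linarith [hcon.1, hcon.2]
    have h4 : absTail P Y z / H z ≤ absTail P (V m) ((1 - ε) * z) / H z +
        absTail P (fun ω => Y ω - V m ω) (ε * z) / H z := by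
      rw [← add_div]
      have := hH.pos z
      gcongr
    linarith

lemma BasicAssumptions.tendsto_absTail_movingAverage (hA : BasicAssumptions P γ π₁ π₂ L c Z X)
    (m : ℕ) (n : ℤ) :
    Tendsto (fun z => absTail P (movingAverage c Z m n) z / absTail P (Z 0) z) atTop
      (𝓝 (∑ j ∈ Finset.range m, |c j| ^ (1 / γ))) := by
  have hγ := hA.gamma_pos
  have hα : 0 < 1 / γ := by positivity
  have hH := hA.regVarTail_innov
  set W : ℕ → Ω → ℝ := fun j ω => c j * Z (n - (j : ℤ)) ω with hW
  have hWm : ∀ j, Measurable (W j) := fun j => (hA.innov_measurable _).const_mul _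
  have hWi : iIndepFun W P := by
    have hinj : Function.Injective fun j : ℕ => n - (j : ℤ) := fun i j h => by simpa using h
    exact (hA.innov_indep.precomp hinj).comp (fun j x => c j * x)
      fun j => measurable_const_mul _
  have hsum : ∀ m, movingAverage c Z m n = ∑ j ∈ Finset.range m, W j := fun m => by
    funext ω; simp [movingAverage, hW]
  induction m with
  | zero =>
    simp only [Finset.range_zero, Finset.sum_empty]
    refine tendsto_const_nhds.congr' ?_
    filter_upwards [eventually_ge_atTop 0] with z hz
    have : absTail P (movingAverage c Z 0 n) z = 0 := by
      simp [absTail, movingAverage, not_lt.2 hz]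
    rw [this, zero_div]
  | succ m ih =>
    rw [Finset.sum_range_succ]
    have hm : Measurable (movingAverage c Z m n) := by
      exact Finset.measurable_fun_sum _ fun j _ => hWm j
    have hind : IndepFun (movingAverage c Z m n) (W m) P := by
      rw [hsum]; exact hWi.indepFun_finsetSum_of_notMem hWm Finset.notMem_range_self
    have htail : Tendsto (fun z => absTail P (W m) z / absTail P (Z 0) z) atTop
        (𝓝 (|c m| ^ (1 / γ))) := by
      have hid : IdentDistrib (W m) (fun ω => c m * Z 0 ω) P P :=
        (hA.innov_identDistrib (n - (m : ℤ))).comp (measurable_const_mul (c m))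
      rw [absTail_congr_identDistrib hid]
      exact tendsto_absTail_const_mul hα hH (c m)
    refine (tendsto_absTail_add_div hα hH hm (hWm m) hind ih htail).congr fun z => ?_
    congr 2
    funext ω
    simp [movingAverage, hW, Finset.sum_range_succ]

/-- The tail of the linear process is proportional to the tail of the innovations. -/
lemma BasicAssumptions.tendsto_absTail_div (hA : BasicAssumptions P γ π₁ π₂ L c Z X) (n : ℤ) :
    Tendsto (fun z => absTail P (X n) z / absTail P (Z 0) z) atTop
      (𝓝 (∑' j, |c j| ^ (1 / γ))) := by
  obtain ⟨σ, hσ, -, z₀, m₀, h⟩ := hA.absTail_remainder_le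
  exact tendsto_absTail_div_of_approx hA.regVarTail_innov
    (fun m => hA.tendsto_absTail_movingAverage m n) hA.summable_rpow.tendsto_sum_tsum_nat hσ
    ⟨m₀, fun m hm => (eventually_ge_atTop z₀).mono fun z hz => h m hm z hz n⟩

lemma BasicAssumptions.tsum_rpow_pos (hA : BasicAssumptions P γ π₁ π₂ L c Z X) :
    0 < ∑' j, |c j| ^ (1 / γ) := by
  obtain ⟨j, hj⟩ := hA.coeff_ne_zero
  exact hA.summable_rpow.tsum_pos (fun j => by positivity) j
    (Real.rpow_pos_of_pos (abs_pos.2 hj) _)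

lemma BasicAssumptions.regVarTail (hA : BasicAssumptions P γ π₁ π₂ L c Z X) (n : ℤ) :
    RegVarTail (absTail P (X n)) (1 / γ) :=
  RegVarTail.of_tendsto_div (absTail_antitone _) (absTail_nonneg _) hA.tsum_rpow_pos
    (hA.tendsto_absTail_div n) hA.regVarTail_innov.ratio

end Tail

section Quantile

/-- The generalized inverse `t ↦ inf {y : t F(y) ≤ 1}` of the reciprocal of a tail function. -/
noncomputable def tailInverse (F : ℝ → ℝ) (t : ℝ) : ℝ := sInf {y : ℝ | t * F y ≤ 1}

namespace RegVarTail

variable {F : ℝ → ℝ} {α : ℝ}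

lemma tailInverse_spec (hF : RegVarTail F α) (hα : 0 < α) (M : ℝ) :
    ∀ᶠ t in atTop, (∃ y, t * F y ≤ 1) ∧ ∀ y, t * F y ≤ 1 → M ≤ y := by
  filter_upwards [eventually_gt_atTop (1 / F M), eventually_gt_atTop 0] with t ht ht0
  constructor
  · obtain ⟨y, hy⟩ := ((hF.tendsto_zero hα).eventually (gt_mem_nhds
      (show (0 : ℝ) < 1 / t by positivity))).exists
    rw [lt_div_iff₀ ht0] at hy
    exact ⟨y, by linarith⟩
  · intro y hy
    by_contra! h
    have h1 := hF.anti h.le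
    rw [div_lt_iff₀ (hF.pos M)] at ht
    nlinarith

lemma tendsto_tailInverse (hF : RegVarTail F α) (hα : 0 < α) :
    Tendsto (tailInverse F) atTop atTop :=
  tendsto_atTop.2 fun M => (hF.tailInverse_spec hα M).mono fun _ ht => le_csInf ht.1 ht.2

lemma mul_tailInverse_le (hF : RegVarTail F α) (hα : 0 < α) {y : ℝ} (hy : 1 < y) :
    ∀ᶠ t in atTop, t * F (y * tailInverse F t) ≤ 1 := by
  filter_upwards [hF.tailInverse_spec hα 0, (hF.tendsto_tailInverse hα).eventually_gt_atTop 0,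
    eventually_gt_atTop 0] with t ht hb ht0
  have h : tailInverse F t < y * tailInverse F t := by nlinarith
  obtain ⟨w, hw1, hw2⟩ := (csInf_lt_iff ⟨0, fun y hy => ht.2 y hy⟩ ht.1).1 h
  have h1 := hF.anti hw2.le
  have h2 : t * F w ≤ 1 := hw1
  nlinarith

lemma one_lt_mul_tailInverse (hF : RegVarTail F α) (hα : 0 < α) {y : ℝ} (hy : y < 1) :
    ∀ᶠ t in atTop, 1 < t * F (y * tailInverse F t) := by
  filter_upwards [hF.tailInverse_spec hα 0, (hF.tendsto_tailInverse hα).eventually_gt_atTop 0]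
    with t ht hb
  by_contra! h
  have h1 : tailInverse F t ≤ y * tailInverse F t := csInf_le ⟨0, fun y hy => ht.2 y hy⟩ h
  nlinarith

lemma tendsto_mul_tailInverse_one (hF : RegVarTail F α) (hα : 0 < α) :
    Tendsto (fun t => t * F (tailInverse F t)) atTop (𝓝 1) := by
  have hb := hF.tendsto_tailInverse hα
  have hlim : ∀ y : ℝ, 0 < y → Tendsto (fun t => F (tailInverse F t) / F (y * tailInverse F t))
      atTop (𝓝 (y ^ α)) := fun y hy => by
    have h := ((hF.ratio y hy).comp hb).inv₀ (by positivity)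
    rw [Real.rpow_neg hy.le, inv_inv] at h
    exact h.congr fun t => by simp
  have hc : ContinuousAt (fun y : ℝ => y ^ α) 1 := continuousAt_id.rpow_const (Or.inl one_ne_zero)
  refine tendsto_order.2 ⟨fun r hr => ?_, fun r hr => ?_⟩
  · have h1 : ∀ᶠ y in 𝓝[<] (1 : ℝ), r < y ^ α :=
      nhdsWithin_le_nhds (hc.eventually (lt_mem_nhds (by simpa using hr)))
    obtain ⟨y, ⟨hy1, hy2⟩, hy3⟩ := ((h1.and (nhdsWithin_le_nhds (lt_mem_nhds one_pos))).and
      self_mem_nhdsWithin).exists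
    filter_upwards [(hlim y hy2).eventually (lt_mem_nhds hy1), hF.one_lt_mul_tailInverse hα hy3]
      with t h2 h3
    have h4 := hF.pos (y * tailInverse F t)
    rw [lt_div_iff₀ h4] at h2
    have h5 := hF.pos (tailInverse F t)
    by_contra! h6
    have h7 : t * F (tailInverse F t) * F (y * tailInverse F t) ≤ r * F (y * tailInverse F t) := by
      gcongr
    nlinarith
  · have h1 : ∀ᶠ y in 𝓝[>] (1 : ℝ), y ^ α < r :=
      nhdsWithin_le_nhds (hc.eventually (gt_mem_nhds (by simpa using hr)))
    obtain ⟨y, hy1, hy3⟩ := (h1.and self_mem_nhdsWithin).exists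
    filter_upwards [(hlim y (one_pos.trans hy3)).eventually (gt_mem_nhds hy1),
      hF.mul_tailInverse_le hα hy3] with t h2 h3
    have h4 := hF.pos (y * tailInverse F t)
    rw [div_lt_iff₀ h4] at h2
    have h5 := hF.pos (tailInverse F t)
    by_contra! h6
    have h7 : r * F (y * tailInverse F t) ≤ t * F (tailInverse F t) * F (y * tailInverse F t) := by
      gcongr
    nlinarith

lemma tendsto_mul_tailInverse (hF : RegVarTail F α) (hα : 0 < α) {y : ℝ} (hy : 0 < y) :
    Tendsto (fun t => t * F (y * tailInverse F t)) atTop (𝓝 (y ^ (-α))) := by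
  have h := (hF.tendsto_mul_tailInverse_one hα).mul
    ((hF.ratio y hy).comp (hF.tendsto_tailInverse hα))
  rw [one_mul] at h
  refine h.congr fun t => ?_
  have := (hF.pos (tailInverse F t)).ne'
  simp only [Function.comp_apply]
  field_simp

end RegVarTail

lemma absQuantile_eq_tailInverse {Ω : Type*} [MeasurableSpace Ω] {P : Measure Ω}
    [IsProbabilityMeasure P] {Y : Ω → ℝ} (hY : AEMeasurable Y P)
    (hpos : ∀ y, 0 < absTail P Y y) (t : ℝ) :
    absQuantile P Y t = tailInverse (absTail P Y) t := by
  unfold absQuantile tailInverse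
  congr 1
  ext y
  have hns : NullMeasurableSet {ω | |Y ω| ≤ y} P :=
    nullMeasurableSet_le hY.abs aemeasurable_const
  have h1 : 1 - P {ω | |Y ω| ≤ y} = ENNReal.ofReal (absTail P Y y) := by
    rw [ofReal_absTail, ← prob_compl_eq_one_sub₀ hns]
    congr 1
    ext ω; simp
  have hp := hpos y
  simp only [Set.mem_ofPred_eq]
  rw [h1, ← ENNReal.ofReal_inv_of_pos hp, ENNReal.ofReal_le_ofReal_iff (by positivity),
    inv_eq_one_div, le_div_iff₀ hp]

end Quantile

section Stationarity

variable {Ω : Type*} [MeasurableSpace Ω] {P : Measure Ω}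
  {γ π₁ π₂ : ℝ} {L : ℝ → ℝ} {c : ℕ → ℝ} {Z X : ℤ → Ω → ℝ}

lemma BasicAssumptions.identDistrib_past (hA : BasicAssumptions P γ π₁ π₂ L c Z X) (n : ℤ) :
    IdentDistrib (fun ω (j : ℕ) => Z (n - (j : ℤ)) ω) (fun ω (j : ℕ) => Z (1 - (j : ℤ)) ω) P P := by
  have hinj : ∀ n : ℤ, Function.Injective fun j : ℕ => n - (j : ℤ) := fun n i j h => by
    simpa using h
  exact IdentDistrib.pi
    (fun j => (hA.innov_identDistrib _).trans (hA.innov_identDistrib _).symm)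
    (hA.innov_indep.precomp (hinj n)) (hA.innov_indep.precomp (hinj 1))

lemma BasicAssumptions.ae_eq_tsum (hA : BasicAssumptions P γ π₁ π₂ L c Z X) (n : ℤ) :
    X n =ᵐ[P] fun ω => ∑' j : ℕ, c j * Z (n - (j : ℤ)) ω :=
  (hA.linear n).mono fun _ h => h.tsum_eq.symm

lemma measurable_tsum_mul (c : ℕ → ℝ) : Measurable fun z : ℕ → ℝ => ∑' j, c j * z j :=
  Measurable.tsum fun j => (measurable_pi_apply j).const_mul _

lemma BasicAssumptions.aemeasurable (hA : BasicAssumptions P γ π₁ π₂ L c Z X) (n : ℤ) :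
    AEMeasurable (X n) P := by
  refine (Measurable.aemeasurable ?_).congr (hA.ae_eq_tsum n).symm
  exact (measurable_tsum_mul c).comp (measurable_pi_lambda _ fun _ => hA.innov_measurable _)

lemma BasicAssumptions.identDistrib (hA : BasicAssumptions P γ π₁ π₂ L c Z X) (n : ℤ) :
    IdentDistrib (X n) (X 1) P P := by
  have h := (hA.identDistrib_past n).comp (measurable_tsum_mul c)
  exact ((IdentDistrib.of_ae_eq (hA.aemeasurable n) (hA.ae_eq_tsum n)).trans h).trans
    (IdentDistrib.of_ae_eq (hA.aemeasurable 1) (hA.ae_eq_tsum 1)).symm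

lemma measurable_movingAverage (hZ : ∀ i, Measurable (Z i)) (m : ℕ) (n : ℤ) :
    Measurable (movingAverage c Z m n) :=
  Finset.measurable_fun_sum _ fun _ _ => (hZ _).const_mul _

lemma indepFun_movingAverage (hZ : ∀ i, Measurable (Z i)) (hind : iIndepFun Z P) {m : ℕ} {i j : ℤ}
    (hij : i + m ≤ j) : IndepFun (movingAverage c Z m i) (movingAverage c Z m j) P := by
  have hdisj : Disjoint (Finset.Ioc (i - m) i) (Finset.Ioc (j - m) j) := by
    rw [Finset.disjoint_left]
    intro l h1 h2
    rw [Finset.mem_Ioc] at h1 h2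
    omega
  have h := hind.indepFun_finset _ _ hdisj hZ
  have hfac : ∀ n : ℤ, ∃ g : (Finset.Ioc (n - m) n → ℝ) → ℝ, Measurable g ∧
      movingAverage c Z m n = g ∘ fun ω (l : Finset.Ioc (n - m) n) => Z l ω := by
    intro n
    have hmem : ∀ j : Finset.range m, n - ((j : ℕ) : ℤ) ∈ Finset.Ioc (n - (m : ℤ)) n := by
      intro j
      have := Finset.mem_range.1 j.2
      rw [Finset.mem_Ioc]
      omega
    refine ⟨fun x => ∑ j : Finset.range m, c j * x ⟨n - ((j : ℕ) : ℤ), hmem j⟩,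
      Finset.measurable_fun_sum _ fun _ _ => (measurable_pi_apply _).const_mul _, ?_⟩
    funext ω
    simp only [movingAverage, Function.comp_apply]
    exact (Finset.sum_coe_sort (Finset.range m) fun j : ℕ => c j * Z (n - (j : ℤ)) ω).symm
  obtain ⟨g, hg, hgi⟩ := hfac i
  obtain ⟨g', hg', hgj⟩ := hfac j
  rw [hgi, hgj]
  exact h.comp hg hg'

end Stationarity

section Counting

variable {Ω : Type*} [MeasurableSpace Ω] {P : Measure Ω} [IsProbabilityMeasure P]

lemma memLp_indicator_one {B : Set Ω} (hB : MeasurableSet B) (p : ℝ≥0∞) :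
    MemLp (B.indicator fun _ => (1 : ℝ)) p P := (memLp_const 1).indicator hB

/-- Variance of the number of occurrences of `m`-dependent events. -/
lemma variance_sum_indicator_le {B : ℕ → Set Ω} (hB : ∀ i, MeasurableSet (B i)) {n m : ℕ} {q : ℝ}
    (hq : ∀ i, P.real (B i) ≤ q)
    (hind : ∀ i j, i + m ≤ j → IndepFun ((B i).indicator fun _ => (1 : ℝ))
      ((B j).indicator fun _ => (1 : ℝ)) P) :
    Var[fun ω => ∑ i ∈ Finset.Icc 1 n, (B i).indicator (fun _ => (1 : ℝ)) ω; P] ≤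
      n * (2 * m * q) := by
  have hL := fun i => memLp_indicator_one (P := P) (hB i) 2
  have hq0 : 0 ≤ q := measureReal_nonneg.trans (hq 0)
  have hcov : ∀ i j, cov[(B i).indicator fun _ => (1 : ℝ), (B j).indicator fun _ => (1 : ℝ); P] ≤
      q := by
    intro i j
    rw [covariance_eq_sub (hL i) (hL j), integral_indicator_const _ (hB i),
      integral_indicator_const _ (hB j)]
    have h1 : ((B i).indicator fun _ => (1 : ℝ)) * ((B j).indicator fun _ => (1 : ℝ)) =
        (B i ∩ B j).indicator fun _ => (1 : ℝ) := by
      funext ω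
      by_cases hi : ω ∈ B i <;> by_cases hj : ω ∈ B j <;> simp [hi, hj]
    rw [h1, integral_indicator_const _ ((hB i).inter (hB j))]
    have h2 : P.real (B i ∩ B j) ≤ P.real (B i) := measureReal_mono Set.inter_subset_left
    have h3 : 0 ≤ P.real (B i) * P.real (B j) := by positivity
    simp only [smul_eq_mul, mul_one]
    linarith [hq i]
  rw [variance_fun_sum' fun i _ => hL i]
  have hrow : ∀ i ∈ Finset.Icc 1 n, ∑ j ∈ Finset.Icc 1 n,
      cov[(B i).indicator fun _ => (1 : ℝ), (B j).indicator fun _ => (1 : ℝ); P] ≤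
        2 * m * q := by
    intro i _
    calc ∑ j ∈ Finset.Icc 1 n,
          cov[(B i).indicator fun _ => (1 : ℝ), (B j).indicator fun _ => (1 : ℝ); P]
        ≤ ∑ j ∈ Finset.Icc 1 n, if j ∈ Finset.Ico (i + 1 - m) (i + m) then q else 0 := by
          refine Finset.sum_le_sum fun j _ => ?_
          split_ifs with h
          · exact hcov i j
          · rw [Finset.mem_Ico] at h
            rcases (by omega : i + m ≤ j ∨ j + m ≤ i) with h1 | h1
            · exact ((hind i j h1).covariance_eq_zero (hL i) (hL j)).le
            · rw [covariance_comm]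
              exact ((hind j i h1).covariance_eq_zero (hL j) (hL i)).le
      _ ≤ ∑ j ∈ Finset.Ico (i + 1 - m) (i + m), q := by
          rw [← Finset.sum_filter]
          refine Finset.sum_le_sum_of_subset_of_nonneg (fun j hj => (Finset.mem_filter.1 hj).2)
            fun _ _ _ => hq0
      _ ≤ 2 * m * q := by
          rw [Finset.sum_const, nsmul_eq_mul, Nat.card_Ico]
          have : i + m - (i + 1 - m) ≤ 2 * m := by omega
          gcongr
          exact_mod_cast this
  refine (Finset.sum_le_sum hrow).trans ?_
  simp

lemma measure_le_sum_indicator_le {D : ℕ → Set Ω} (hD : ∀ i, NullMeasurableSet (D i) P) {n : ℕ}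
    {d ε : ℝ} (hd : ∀ i, P.real (D i) ≤ d) (hε : 0 < ε) :
    P {ω | ε ≤ ∑ i ∈ Finset.Icc 1 n, (D i).indicator (fun _ => (1 : ℝ)) ω} ≤
      ENNReal.ofReal (n * d / ε) := by
  have hd0 : 0 ≤ d := measureReal_nonneg.trans (hd 0)
  have hm : AEMeasurable (fun ω => ∑ i ∈ Finset.Icc 1 n,
      (D i).indicator (fun _ => (1 : ℝ≥0∞)) ω) P :=
    Finset.aemeasurable_fun_sum _ fun i _ => aemeasurable_const.indicator₀ (hD i)
  have hsub : {ω | ε ≤ ∑ i ∈ Finset.Icc 1 n, (D i).indicator (fun _ => (1 : ℝ)) ω} ⊆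
      {ω | ENNReal.ofReal ε ≤ ∑ i ∈ Finset.Icc 1 n, (D i).indicator (fun _ => (1 : ℝ≥0∞)) ω} := by
    intro ω (hω : ε ≤ _)
    refine (ENNReal.ofReal_le_ofReal hω).trans ?_
    rw [ENNReal.ofReal_sum_of_nonneg fun i _ => Set.indicator_nonneg (fun _ _ => zero_le_one) ω]
    refine Finset.sum_le_sum fun i _ => ?_
    by_cases h : ω ∈ D i <;> simp [h]
  refine (measure_mono hsub).trans ?_
  rw [ENNReal.ofReal_div_of_pos hε]
  refine (meas_ge_le_lintegral_div hm (by simpa using hε) ENNReal.ofReal_ne_top).trans ?_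
  gcongr
  rw [lintegral_finsetSum' _ fun i _ => aemeasurable_const.indicator₀ (hD i)]
  calc ∑ i ∈ Finset.Icc 1 n, ∫⁻ ω, (D i).indicator (fun _ => (1 : ℝ≥0∞)) ω ∂P
      ≤ ∑ i ∈ Finset.Icc 1 n, ENNReal.ofReal d := by
        refine Finset.sum_le_sum fun i _ => ?_
        rw [lintegral_indicator_const₀ (hD i), one_mul, ← ofReal_measureReal]
        exact ENNReal.ofReal_le_ofReal (hd i)
    _ = _ := by
        rw [Finset.sum_const, Nat.card_Icc, nsmul_eq_mul, ENNReal.ofReal_mul (by positivity)]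
        simp

/-- A weak law for events that are well approximated by `m`-dependent ones. -/
lemma measure_count_deviation_le {A B : ℕ → Set Ω} (hA : ∀ i, NullMeasurableSet (A i) P)
    (hB : ∀ i, MeasurableSet (B i)) {n m : ℕ} {q d a ε : ℝ} (hq : ∀ i, P.real (B i) ≤ q)
    (hd : ∀ i, P.real (symmDiff (A i) (B i)) ≤ d)
    (hind : ∀ i j, i + m ≤ j → IndepFun ((B i).indicator fun _ => (1 : ℝ))
      ((B j).indicator fun _ => (1 : ℝ)) P)
    (ha : |∑ i ∈ Finset.Icc 1 n, P.real (B i) - a| < ε) :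
    P {ω | 3 * ε ≤ |∑ i ∈ Finset.Icc 1 n, (A i).indicator (fun _ => (1 : ℝ)) ω - a|} ≤
      ENNReal.ofReal (n * d / ε + n * (2 * m * q) / ε ^ 2) := by
  have hε : 0 < ε := (abs_nonneg _).trans_lt ha
  have hd0 : 0 ≤ d := measureReal_nonneg.trans (hd 0)
  have hq0 : 0 ≤ q := measureReal_nonneg.trans (hq 0)
  set SB : Ω → ℝ := fun ω => ∑ i ∈ Finset.Icc 1 n, (B i).indicator (fun _ => (1 : ℝ)) ω with hSB
  have hL : MemLp SB 2 P := memLp_finsetSum _ fun i _ => memLp_indicator_one (hB i) 2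
  have hmean : ∫ ω, SB ω ∂P = ∑ i ∈ Finset.Icc 1 n, P.real (B i) := by
    rw [hSB, integral_finsetSum _ fun i _ => (integrable_const _).indicator (hB i)]
    simp [integral_indicator_const, hB]
  have hsub : {ω | 3 * ε ≤ |∑ i ∈ Finset.Icc 1 n, (A i).indicator (fun _ => (1 : ℝ)) ω - a|} ⊆
      {ω | ε ≤ ∑ i ∈ Finset.Icc 1 n, (symmDiff (A i) (B i)).indicator (fun _ => (1 : ℝ)) ω} ∪
      {ω | ε ≤ |SB ω - ∫ ω, SB ω ∂P|} := by
    intro ω hω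
    by_contra hcon
    simp only [Set.mem_union, Set.mem_ofPred_eq, not_or, not_le] at hcon hω
    have h1 : |∑ i ∈ Finset.Icc 1 n, (A i).indicator (fun _ => (1 : ℝ)) ω - SB ω| ≤
        ∑ i ∈ Finset.Icc 1 n, (symmDiff (A i) (B i)).indicator (fun _ => (1 : ℝ)) ω := by
      rw [hSB, ← Finset.sum_sub_distrib]
      refine (Finset.abs_sum_le_sum_abs _ _).trans (Finset.sum_le_sum fun i _ => ?_)
      by_cases h1 : ω ∈ A i <;> by_cases h2 : ω ∈ B i <;> simp [h1, h2, Set.mem_symmDiff]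
    rw [hmean] at hcon
    have h2 := abs_sub_le (∑ i ∈ Finset.Icc 1 n, (A i).indicator (fun _ => (1 : ℝ)) ω) (SB ω) a
    have h3 := abs_sub_le (SB ω) (∑ i ∈ Finset.Icc 1 n, P.real (B i)) a
    linarith [hcon.1, hcon.2]
  rw [ENNReal.ofReal_add (by positivity) (by positivity)]
  refine (measure_mono hsub).trans ((measure_union_le _ _).trans (add_le_add ?_ ?_))
  · exact measure_le_sum_indicator_le (fun i => (hA i).symmDiff (hB i).nullMeasurableSet) hd hε
  · refine (meas_ge_le_variance_div_sq hL hε).trans (ENNReal.ofReal_le_ofReal ?_)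
    gcongr
    exact variance_sum_indicator_le hB hq hind

end Counting

section Regime

lemma tendsto_snd_tailRegime : Tendsto (fun p : ℕ × ℕ => p.2) tailRegime atTop :=
  tendsto_comap.mono_left (inf_le_left.trans inf_le_right)

lemma tendsto_ratio_tailRegime :
    Tendsto (fun p : ℕ × ℕ => (p.1 : ℝ) / (p.2 : ℝ)) tailRegime atTop :=
  tendsto_comap.mono_left inf_le_right

end Regime

section TailEmpirical

variable {Ω : Type*} [MeasurableSpace Ω] {P : Measure Ω} [IsProbabilityMeasure P]
  {γ π₁ π₂ : ℝ} {L : ℝ → ℝ} {c : ℕ → ℝ} {Z X : ℤ → Ω → ℝ}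

lemma BasicAssumptions.scale_eq (hA : BasicAssumptions P γ π₁ π₂ L c Z X) (n k : ℕ) :
    scale P X n k = tailInverse (absTail P (X 1)) ((n : ℝ) / k) :=
  absQuantile_eq_tailInverse (hA.aemeasurable 1) (hA.regVarTail 1).pos _

lemma BasicAssumptions.tendsto_scale (hA : BasicAssumptions P γ π₁ π₂ L c Z X) :
    Tendsto (fun p : ℕ × ℕ => scale P X p.1 p.2) tailRegime atTop := by
  have hγ := hA.gamma_pos
  simp_rw [hA.scale_eq]
  exact ((hA.regVarTail 1).tendsto_tailInverse (by positivity)).comp tendsto_ratio_tailRegime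

lemma BasicAssumptions.tendsto_ratio_mul_absTail (hA : BasicAssumptions P γ π₁ π₂ L c Z X)
    {y : ℝ} (hy : 0 < y) :
    Tendsto (fun p : ℕ × ℕ => (p.1 : ℝ) / p.2 * absTail P (X 1) (y * scale P X p.1 p.2))
      tailRegime (𝓝 (y ^ (-(1 / γ)))) := by
  have hγ := hA.gamma_pos
  simp_rw [hA.scale_eq]
  exact ((hA.regVarTail 1).tendsto_mul_tailInverse (by positivity) hy).comp
    tendsto_ratio_tailRegime

lemma BasicAssumptions.tendsto_ratio_mul_absTail_innov
    (hA : BasicAssumptions P γ π₁ π₂ L c Z X) {y : ℝ} (hy : 0 < y) :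
    Tendsto (fun p : ℕ × ℕ => (p.1 : ℝ) / p.2 * absTail P (Z 0) (y * scale P X p.1 p.2))
      tailRegime (𝓝 (y ^ (-(1 / γ)) / ∑' j, |c j| ^ (1 / γ))) := by
  have h1 := (hA.tendsto_absTail_div 1).comp (hA.tendsto_scale.const_mul_atTop hy)
  refine ((hA.tendsto_ratio_mul_absTail hy).div h1 hA.tsum_rpow_pos.ne').congr fun p => ?_
  have h2 := (hA.regVarTail_innov.pos (y * scale P X p.1 p.2)).ne'
  have h3 := ((hA.regVarTail 1).pos (y * scale P X p.1 p.2)).ne'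
  simp only [Function.comp_apply, Pi.div_apply]
  field_simp

lemma measureReal_symmDiff_le {Y V : Ω → ℝ} (hY : AEMeasurable Y P) {u ε : ℝ}
    (hu : 0 < u) (hε : 0 < ε) :
    P.real (symmDiff {ω | u < |Y ω|} {ω | u < |V ω|}) ≤
      absTail P (fun ω => Y ω - V ω) (ε * u) +
        (absTail P Y ((1 - ε) * u) - absTail P Y ((1 + ε) * u)) := by
  have hns : NullMeasurableSet {ω | (1 + ε) * u < |Y ω|} P :=
    nullMeasurableSet_lt aemeasurable_const hY.abs
  have h1 : {ω | (1 + ε) * u < |Y ω|} ⊆ {ω | (1 - ε) * u < |Y ω|} := fun ω hω =>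
    lt_of_le_of_lt (mul_le_mul_of_nonneg_right (by linarith) hu.le) hω
  have h2 := measureReal_inter_add_sdiff₀ (s := {ω | (1 - ε) * u < |Y ω|}) hns
  rw [Set.inter_eq_right.2 h1] at h2
  rw [absTail, absTail, absTail, sub_eq_of_eq_add' h2.symm]
  refine (measureReal_mono fun ω hω => ?_).trans (measureReal_union_le _ _)
  have h3 := abs_sub_abs_le_abs_sub (Y ω) (V ω)
  have h4 := abs_sub_abs_le_abs_sub (V ω) (Y ω)
  rw [abs_sub_comm] at h4
  by_contra hcon
  simp only [Set.mem_union, Set.mem_sdiff, Set.mem_ofPred_eq, not_or, not_and_or, not_lt]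
    at hcon
  rcases hω with ⟨h5, h6⟩ | ⟨h5, h6⟩ <;> simp only [Set.mem_ofPred_eq, not_lt] at h5 h6 <;>
    rcases hcon with ⟨h7, h8 | h8⟩ <;> nlinarith

/-- The exceedances of the linear process are approximated by those of finite moving averages. -/
lemma BasicAssumptions.eventually_symmDiff_le (hA : BasicAssumptions P γ π₁ π₂ L c Z X)
    {z η : ℝ} (hz : 0 < z) (hη : 0 < η) :
    ∃ m : ℕ, ∀ᶠ p in tailRegime, ∀ i : ℤ, (p.1 : ℝ) / p.2 *
      P.real (symmDiff {ω | z * scale P X p.1 p.2 < |X i ω|}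
        {ω | z * scale P X p.1 p.2 < |movingAverage c Z m i ω|}) < η := by
  obtain ⟨σ, hσ, hσ0, z₀, m₀, hrem⟩ := hA.absTail_remainder_le
  have hc : ContinuousAt (fun ε : ℝ =>
      ((1 - ε) * z) ^ (-(1 / γ)) - ((1 + ε) * z) ^ (-(1 / γ))) 0 := by
    refine ContinuousAt.sub ?_ ?_ <;>
      refine ContinuousAt.rpow_const (by fun_prop) (Or.inl ?_) <;> simpa using hz.ne'
  have h1 : ∀ᶠ ε in 𝓝[>] (0 : ℝ),
      ((1 - ε) * z) ^ (-(1 / γ)) - ((1 + ε) * z) ^ (-(1 / γ)) < η :=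
    nhdsWithin_le_nhds (hc.eventually (gt_mem_nhds (by simpa using hη)))
  obtain ⟨ε, ⟨hε, hε1⟩, hε0⟩ := ((h1.and (nhdsWithin_le_nhds (gt_mem_nhds one_pos))).and
    self_mem_nhdsWithin).exists
  have hε0 : 0 < ε := hε0
  have h2 : Tendsto (fun m => σ m * ((ε * z) ^ (-(1 / γ)) / ∑' j, |c j| ^ (1 / γ)) +
      (((1 - ε) * z) ^ (-(1 / γ)) - ((1 + ε) * z) ^ (-(1 / γ)))) atTop
      (𝓝 (((1 - ε) * z) ^ (-(1 / γ)) - ((1 + ε) * z) ^ (-(1 / γ)))) := by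
    simpa using (hσ.mul_const ((ε * z) ^ (-(1 / γ)) / ∑' j, |c j| ^ (1 / γ))).add_const
      (((1 - ε) * z) ^ (-(1 / γ)) - ((1 + ε) * z) ^ (-(1 / γ)))
  obtain ⟨m, hm, hm0⟩ := ((h2.eventually (gt_mem_nhds hε)).and (eventually_ge_atTop m₀)).exists
  refine ⟨m, ?_⟩
  have hεz : 0 < ε * z := by positivity
  have h3 := ((hA.tendsto_ratio_mul_absTail_innov hεz).const_mul (σ m)).add
    ((hA.tendsto_ratio_mul_absTail (y := (1 - ε) * z) (mul_pos (by linarith) hz)).sub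
      (hA.tendsto_ratio_mul_absTail (y := (1 + ε) * z) (by positivity)))
  filter_upwards [h3.eventually (gt_mem_nhds hm), hA.tendsto_scale.eventually_gt_atTop 0,
    (hA.tendsto_scale.const_mul_atTop hεz).eventually_ge_atTop z₀] with p hp hs hpz i
  refine lt_of_le_of_lt ?_ hp
  have h4 := measureReal_symmDiff_le (V := movingAverage c Z m i) (hA.aemeasurable i)
    (mul_pos hz hs) hε0
  have h5 := hrem m hm0 _ hpz i
  rw [absTail_congr_identDistrib (hA.identDistrib i)] at h4
  simp only [← mul_assoc] at h4 h5 ⊢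
  have h6 : (0 : ℝ) ≤ (p.1 : ℝ) / p.2 := by positivity
  refine (mul_le_mul_of_nonneg_left (h4.trans (add_le_add_left h5 _)) h6).trans (le_of_eq ?_)
  ring

lemma BasicAssumptions.tendsto_count (hA : BasicAssumptions P γ π₁ π₂ L c Z X)
    {z ε : ℝ} (hz : 0 < z) (hε : 0 < ε) :
    Tendsto (fun p : ℕ × ℕ => P {ω | 3 * (p.2 * ε) ≤ |∑ i ∈ Finset.Icc 1 p.1,
      {ω | z * scale P X p.1 p.2 < |X (i : ℤ) ω|}.indicator (fun _ => (1 : ℝ)) ω -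
        p.2 * z ^ (-(1 / γ))|}) tailRegime (𝓝 0) := by
  rw [ENNReal.tendsto_nhds_zero]
  intro τ hτ
  obtain ⟨r, hr0, hrτ⟩ : ∃ r : ℝ, 0 < r ∧ ENNReal.ofReal r ≤ τ := by
    rcases eq_or_ne τ ∞ with rfl | h
    · exact ⟨1, one_pos, le_top⟩
    · exact ⟨τ.toReal, ENNReal.toReal_pos hτ.ne' h, ENNReal.ofReal_toReal_le⟩
  set η := min (ε / 2) (r * ε / 2) with hη
  have hη0 : 0 < η := by positivity
  obtain ⟨m, hm⟩ := hA.eventually_symmDiff_le hz hη0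
  have hF := hA.tendsto_ratio_mul_absTail hz
  have hclose : ∀ᶠ p : ℕ × ℕ in tailRegime, |(p.1 : ℝ) / p.2 *
      absTail P (X 1) (z * scale P X p.1 p.2) - z ^ (-(1 / γ))| < ε / 2 := by
    have := hF.eventually (Metric.ball_mem_nhds _ (half_pos hε))
    simpa [Real.dist_eq] using this
  have hkr : Tendsto (fun p : ℕ × ℕ => (p.2 : ℝ)) tailRegime atTop :=
    tendsto_natCast_atTop_atTop.comp tendsto_snd_tailRegime
  have hvar : Tendsto (fun p : ℕ × ℕ => 2 * m * ((p.1 : ℝ) / p.2 *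
      absTail P (X 1) (z * scale P X p.1 p.2) + η) / ε ^ 2 / p.2) tailRegime (𝓝 0) :=
    (((hF.add_const η).const_mul (2 * (m : ℝ))).div_const (ε ^ 2)).div_atTop hkr
  filter_upwards [hm, hclose, hvar.eventually (gt_mem_nhds (half_pos hr0)),
    hkr.eventually_gt_atTop 0, tendsto_ratio_tailRegime.eventually_gt_atTop 0] with p h1 h2 h3 h4 h5
  obtain ⟨n, k⟩ := p
  simp only at h1 h2 h3 h4 h5 ⊢
  have hn : (0 : ℝ) < n := by
    by_contra! h
    exact absurd h5 (not_lt.2 (div_nonpos_of_nonpos_of_nonneg h h4.le))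
  set u := z * scale P X n k
  set F := absTail P (X 1) u with hFdef
  set d := η * k / n with hd
  have hdpos : 0 < d := by positivity
  have hdi : ∀ i : ℤ, P.real (symmDiff {ω | u < |X i ω|} {ω | u < |movingAverage c Z m i ω|}) ≤
      d := fun i => by
    have := h1 i
    rw [hd, le_div_iff₀ hn]
    rw [div_mul_eq_mul_div, div_lt_iff₀ h4] at this
    linarith
  have hXi : ∀ i : ℤ, P.real {ω | u < |X i ω|} = F := fun i =>
    congrFun (absTail_congr_identDistrib (hA.identDistrib i)) u
  have hVi : ∀ i : ℤ, |P.real {ω | u < |movingAverage c Z m i ω|} - F| ≤ d := fun i => by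
    have hmeas : MeasurableSet {ω | u < |movingAverage c Z m i ω|} :=
      measurableSet_lt measurable_const (measurable_movingAverage hA.innov_measurable m i).abs
    have hns : NullMeasurableSet {ω | u < |X i ω|} P :=
      nullMeasurableSet_lt aemeasurable_const (hA.aemeasurable i).abs
    rw [← hXi i, abs_le]
    have hsub : ∀ A B : Set Ω, P.real A ≤ P.real B + P.real (symmDiff A B) := fun A B => by
      refine (measureReal_mono fun ω hω => ?_).trans (measureReal_union_le _ _)
      by_cases h : ω ∈ B
      · exact Or.inl h
      · exact Or.inr (Or.inl ⟨hω, h⟩)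
    have e1 := hsub {ω | u < |X i ω|} {ω | u < |movingAverage c Z m i ω|}
    have e2 := hsub {ω | u < |movingAverage c Z m i ω|} {ω | u < |X i ω|}
    rw [symmDiff_comm] at e2
    constructor <;> linarith [hdi i]
  have hnd : n * d = k * η := by rw [hd]; field_simp
  have hmain := measure_count_deviation_le (P := P) (A := fun i : ℕ => {ω | u < |X (i : ℤ) ω|})
    (B := fun i : ℕ => {ω | u < |movingAverage c Z m (i : ℤ) ω|}) (n := n) (m := m)
    (q := F + d) (d := d) (a := k * z ^ (-(1 / γ))) (ε := k * ε)
    (fun i => nullMeasurableSet_lt aemeasurable_const (hA.aemeasurable i).abs)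
    (fun i => measurableSet_lt measurable_const
      (measurable_movingAverage hA.innov_measurable m i).abs)
    (fun i => by linarith [(abs_le.1 (hVi i)).2]) (fun i => hdi i)
    (fun i j hij => by
      have hind : IndepFun (movingAverage c Z m (i : ℤ)) (movingAverage c Z m (j : ℤ)) P :=
        indepFun_movingAverage hA.innov_measurable hA.innov_indep (by exact_mod_cast hij)
      have hms : MeasurableSet {x : ℝ | u < |x|} :=
        measurableSet_lt measurable_const measurable_id.abs
      have hφ : Measurable ({x : ℝ | u < |x|}.indicator fun _ => (1 : ℝ)) :=
        measurable_const.indicator hms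
      exact hind.comp hφ hφ)
    (by
      have e1 : |∑ i ∈ Finset.Icc 1 n, P.real {ω | u < |movingAverage c Z m (i : ℤ) ω|} - n * F| ≤
          n * d := by
        have : (n : ℝ) * F = ∑ i ∈ Finset.Icc 1 n, F := by simp
        rw [this, ← Finset.sum_sub_distrib]
        refine (Finset.abs_sum_le_sum_abs _ _).trans ((Finset.sum_le_sum fun (i : ℕ) _ =>
          hVi (i : ℤ)).trans ?_)
        simp
      have e2 : |n * F - k * z ^ (-(1 / γ))| < k * (ε / 2) := by
        have : n * F - k * z ^ (-(1 / γ)) = k * ((n : ℝ) / k * F - z ^ (-(1 / γ))) := by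
          field_simp
        rw [this, abs_mul, abs_of_pos h4]
        gcongr
      have e3 : (k : ℝ) * η ≤ k * (ε / 2) := by gcongr; exact min_le_left _ _
      have e4 := abs_sub_le (∑ i ∈ Finset.Icc 1 n,
        P.real {ω | u < |movingAverage c Z m (i : ℤ) ω|}) (n * F) (k * z ^ (-(1 / γ)))
      linarith)
  refine hmain.trans (le_trans (ENNReal.ofReal_le_ofReal ?_) hrτ)
  have e1 : n * d / (k * ε) ≤ r / 2 := by
    rw [hnd, mul_div_mul_left _ _ h4.ne', div_le_iff₀ hε]
    exact (min_le_right _ _).trans (by linarith)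
  have e2 : n * (2 * m * (F + d)) / (k * ε) ^ 2 =
      2 * m * ((n : ℝ) / k * F + η) / ε ^ 2 / k := by
    rw [hd]; field_simp
  rw [e2]
  linarith

lemma BasicAssumptions.tendstoInMeasure_tailEmpirical
    (hA : BasicAssumptions P γ π₁ π₂ L c Z X) {z : ℝ} (hz : 0 < z) :
    TendstoInMeasure P (fun (p : ℕ × ℕ) ω => tailEmpirical P X p.1 p.2 z ω) tailRegime
      (fun _ => z ^ (-1 / γ)) := by
  rw [tendstoInMeasure_iff_dist]
  intro ε hε
  have h := hA.tendsto_count hz (show 0 < ε / 3 by positivity)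
  refine h.congr' ?_
  filter_upwards [hA.tendsto_scale.eventually_gt_atTop 0,
    tendsto_snd_tailRegime.eventually_gt_atTop 0] with p hs hk
  have hk' : (0 : ℝ) < p.2 := by exact_mod_cast hk
  congr 1
  ext ω
  simp only [Set.mem_ofPred_eq, Real.dist_eq]
  have h1 : ∀ i : ℕ, {ω | z * scale P X p.1 p.2 < |X (i : ℤ) ω|}.indicator (fun _ => (1 : ℝ)) ω =
      (Set.Ioi z).indicator (fun _ => (1 : ℝ)) (|X (i : ℤ) ω| / scale P X p.1 p.2) := fun i => by
    simp only [Set.indicator_apply, Set.mem_ofPred_eq, Set.mem_Ioi, lt_div_iff₀ hs]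
  have h2 : tailEmpirical P X p.1 p.2 z ω - z ^ (-1 / γ) = (1 / (p.2 : ℝ)) *
      (∑ i ∈ Finset.Icc 1 p.1, {ω | z * scale P X p.1 p.2 < |X (i : ℤ) ω|}.indicator
        (fun _ => (1 : ℝ)) ω - p.2 * z ^ (-(1 / γ))) := by
    simp_rw [h1]
    rw [tailEmpirical, mul_sub, ← mul_assoc (1 / (p.2 : ℝ)), one_div_mul_cancel hk'.ne', one_mul,
      neg_div]
  rw [h2, abs_mul, abs_of_pos (one_div_pos.2 hk'), one_div_mul_eq_div, le_div_iff₀ hk']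
  ring_nf

end TailEmpirical

section OrderStatistics

lemma orderStat_nonneg {n : ℕ} {x : Fin n → ℝ} (hx : ∀ i, 0 ≤ x i) (i : ℕ) :
    0 ≤ orderStat x i := by
  unfold orderStat
  split_ifs
  · exact hx _
  · exact le_rfl

lemma lt_orderStat_iff {n : ℕ} (x : Fin n → ℝ) {u : ℝ} (hu : 0 ≤ u) (m : ℕ) :
    u < orderStat x (n - m) ↔ m < (Finset.univ.filter fun i => u < x i).card := by
  have hle : (Finset.univ.filter fun i => u < x i).card ≤ n := by
    simpa using Finset.card_filter_le (Finset.univ : Finset (Fin n)) fun i => u < x i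
  rcases lt_or_ge m n with hm | hm
  · have h : 1 ≤ n - m ∧ n - m ≤ n := by omega
    rw [orderStat, dif_pos h]
    set y : Fin n → ℝ := x ∘ Tuple.sort x with hy
    have hmono : Monotone y := Tuple.monotone_sort x
    set a : Fin n := ⟨n - m - 1, by omega⟩ with ha
    have hcard : (Finset.univ.filter fun i => u < x i).card =
        (Finset.univ.filter fun i => u < y i).card := by
      refine (Finset.card_bij (fun i _ => Tuple.sort x i) (fun i hi => ?_)
        (fun i _ j _ hij => (Tuple.sort x).injective hij) fun i hi => ?_).symm
      · simpa [hy] using hi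
      · exact ⟨(Tuple.sort x).symm i, by simpa [hy] using hi, by simp⟩
    rw [hcard]
    change u < y a ↔ _
    constructor
    · intro h1
      have hsub : Finset.Ici a ⊆ Finset.univ.filter fun i => u < y i := fun i hi => by
        simpa using h1.trans_le (hmono (Finset.mem_Ici.1 hi))
      have h2 := Finset.card_le_card hsub
      rw [Fin.card_Ici] at h2
      simp only [ha] at h2
      omega
    · intro h1
      by_contra! h2
      have hsub : (Finset.univ.filter fun i => u < y i) ⊆ Finset.Ioi a := fun i hi => by
        rw [Finset.mem_Ioi]
        by_contra! h3
        exact absurd ((Finset.mem_filter.1 hi).2) (not_lt.2 ((hmono h3).trans h2))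
      have h3 := Finset.card_le_card hsub
      rw [Fin.card_Ioi] at h3
      simp only [ha] at h3
      omega
  · have h : ¬(1 ≤ n - m ∧ n - m ≤ n) := by omega
    rw [orderStat, dif_neg h]
    exact ⟨fun h1 => absurd h1 (not_lt.2 hu), fun h1 => by omega⟩

variable {Ω : Type*} [MeasurableSpace Ω] {P : Measure Ω} {X : ℤ → Ω → ℝ}

lemma mul_tailEmpirical_eq_card {n k : ℕ} (hk : 0 < k) (hs : 0 < scale P X n k) (z : ℝ) (ω : Ω) :
    k * tailEmpirical P X n k z ω =
      (Finset.univ.filter fun j : Fin n => z * scale P X n k < |X ((j : ℤ) + 1) ω|).card := by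
  have hk' : (k : ℝ) ≠ 0 := by positivity
  have hI : Finset.Icc 1 n = Finset.Ico (0 + 1) (n + 1) := by
    ext i
    simp only [Finset.mem_Icc, Finset.mem_Ico]
    omega
  rw [tailEmpirical, ← mul_assoc, mul_one_div_cancel hk', one_mul, Finset.card_filter, hI,
    ← Finset.sum_Ico_add', ← Finset.range_eq_Ico, ← Fin.sum_univ_eq_sum_range]
  push_cast
  refine Finset.sum_congr rfl fun j _ => ?_
  simp only [Set.indicator_apply, Set.mem_Ioi, lt_div_iff₀ hs]

/-- Duality between the tail quantile process and the tail empirical measure. -/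
lemma lt_absOrderStat_div_scale_iff {n k : ℕ} (hk : 0 < k) (hs : 0 < scale P X n k) {z : ℝ}
    (hz : 0 ≤ z) (m : ℕ) (ω : Ω) :
    z < absOrderStat X n (n - m) ω / scale P X n k ↔ (m : ℝ) < k * tailEmpirical P X n k z ω := by
  rw [mul_tailEmpirical_eq_card hk hs, lt_div_iff₀ hs, absOrderStat,
    lt_orderStat_iff _ (by positivity), Nat.cast_lt]

lemma tailQuantile_nonneg {n k : ℕ} (hs : 0 < scale P X n k) (s : ℝ) (ω : Ω) :
    0 ≤ tailQuantile P X n k s ω :=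
  div_nonneg (orderStat_nonneg (fun _ => abs_nonneg _) _) hs.le

lemma tailQuantile_antitone {n k : ℕ} (hk : 0 < k) (hs : 0 < scale P X n k) (ω : Ω) :
    Antitone fun s => tailQuantile P X n k s ω := by
  intro s t hst
  refine le_of_forall_lt fun z hz => ?_
  rcases lt_or_ge z 0 with h | h
  · exact h.trans_le (tailQuantile_nonneg hs s ω)
  · have h1 := (lt_absOrderStat_div_scale_iff hk hs h _ ω).1 hz
    refine (lt_absOrderStat_div_scale_iff hk hs h _ ω).2 (lt_of_le_of_lt ?_ h1)
    exact_mod_cast Nat.ceil_mono (by gcongr)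

end OrderStatistics

section Uniform

/-- Pólya's argument: pointwise closeness of antitone functions on a finite set forces
uniform closeness to a continuous limit on a compact interval. -/
lemma exists_finset_forall_abs_sub_lt {f : ℝ → ℝ} (hf : ContinuousOn f (Set.Ioi 0))
    (hf' : AntitoneOn f (Set.Ioi 0)) {a b ε : ℝ} (ha : 0 < a) (hε : 0 < ε) :
    ∃ G : Finset ℝ, (∀ g ∈ G, 0 < g) ∧ ∀ T : ℝ → ℝ, Antitone T →
      (∀ g ∈ G, |T g - f g| < ε / 2) → ∀ s ∈ Set.Icc a b, |T s - f s| < ε := by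
  have hloc : ∀ x : ℝ, ∃ l r : ℝ, a ≤ x → 0 < l ∧ l < x ∧ x < r ∧ f l - f r < ε / 2 := by
    intro x
    by_cases hx : a ≤ x
    · have hx0 : 0 < x := ha.trans_le hx
      have hc : ContinuousAt f x := hf.continuousAt (Ioi_mem_nhds hx0)
      obtain ⟨δ, hδ, h⟩ := Metric.continuousAt_iff.1 hc (ε / 4) (by positivity)
      have h1 : 0 < min (δ / 2) (x / 2) := by positivity
      have h2 : min (δ / 2) (x / 2) ≤ δ / 2 := min_le_left _ _
      have h3 : min (δ / 2) (x / 2) ≤ x / 2 := min_le_right _ _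
      refine ⟨x - min (δ / 2) (x / 2), x + min (δ / 2) (x / 2), fun _ =>
        ⟨by linarith, by linarith, by linarith, ?_⟩⟩
      have e1 := h (x := x - min (δ / 2) (x / 2)) (by
        rw [Real.dist_eq, sub_sub_cancel_left, abs_neg, abs_of_pos h1]; linarith)
      have e2 := h (x := x + min (δ / 2) (x / 2)) (by
        rw [Real.dist_eq, add_sub_cancel_left, abs_of_pos h1]; linarith)
      rw [Real.dist_eq, abs_lt] at e1 e2
      linarith [e1.2, e2.1]
    · exact ⟨0, 0, fun h => absurd h hx⟩
  choose l r hlr using hloc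
  obtain ⟨t, ht, hcov⟩ := (isCompact_Icc (a := a) (b := b)).elim_nhds_subcover
    (fun x => Set.Ioo (l x) (r x)) fun x hx => Ioo_mem_nhds (hlr x hx.1).2.1 (hlr x hx.1).2.2.1
  refine ⟨t.image l ∪ t.image r, fun g hg => ?_, fun T hT hG s hs => ?_⟩
  · simp only [Finset.mem_union, Finset.mem_image] at hg
    rcases hg with ⟨x, hx, rfl⟩ | ⟨x, hx, rfl⟩
    · exact (hlr x (ht x hx).1).1
    · obtain ⟨h1, h2, h3, -⟩ := hlr x (ht x hx).1
      linarith
  · obtain ⟨x, hx, hsx⟩ := Set.mem_iUnion₂.1 (hcov hs)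
    obtain ⟨h1, h2, h3, h4⟩ := hlr x (ht x hx).1
    have e1 := hG (l x) (Finset.mem_union_left _ (Finset.mem_image_of_mem _ hx))
    have e2 := hG (r x) (Finset.mem_union_right _ (Finset.mem_image_of_mem _ hx))
    have hs0 : 0 < s := ha.trans_le hs.1
    have m1 := hT hsx.1.le
    have m2 := hT hsx.2.le
    have m3 := hf' (show l x ∈ Set.Ioi 0 from h1) (show s ∈ Set.Ioi 0 from hs0) hsx.1.le
    have m4 := hf' (show s ∈ Set.Ioi 0 from hs0) (show r x ∈ Set.Ioi 0 from hs0.trans hsx.2)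
      hsx.2.le
    rw [abs_lt] at e1 e2 ⊢
    constructor <;> linarith [e1.1, e1.2, e2.1, e2.2]

variable {Ω : Type*} [MeasurableSpace Ω] {P : Measure Ω} [IsProbabilityMeasure P]
  {γ π₁ π₂ : ℝ} {L : ℝ → ℝ} {c : ℕ → ℝ} {Z X : ℤ → Ω → ℝ}

lemma BasicAssumptions.tendsto_tailEmpirical (hA : BasicAssumptions P γ π₁ π₂ L c Z X) {z η : ℝ}
    (hz : 0 < z) (hη : 0 < η) :
    Tendsto (fun p : ℕ × ℕ => P {ω | η ≤ |tailEmpirical P X p.1 p.2 z ω - z ^ (-1 / γ)|})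
      tailRegime (𝓝 0) := by
  simpa only [Real.dist_eq] using
    (tendstoInMeasure_iff_dist.1 (hA.tendstoInMeasure_tailEmpirical hz)) η hη

/-- Convergence of the tail quantile process at a fixed point. -/
lemma BasicAssumptions.tendsto_tailQuantile (hA : BasicAssumptions P γ π₁ π₂ L c Z X) {s ε : ℝ}
    (hs : 0 < s) (hε : 0 < ε) :
    Tendsto (fun p : ℕ × ℕ => P {ω | ε ≤ |tailQuantile P X p.1 p.2 s ω - s ^ (-γ)|})
      tailRegime (𝓝 0) := by
  have hγ := hA.gamma_pos
  have hsγ : 0 < s ^ (-γ) := by positivity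
  have hinv : (s ^ (-γ)) ^ (-1 / γ) = s := by
    rw [← Real.rpow_mul hs.le]
    have : -γ * (-1 / γ) = 1 := by field_simp
    rw [this, Real.rpow_one]
  have hneg : -1 / γ < 0 := div_neg_of_neg_of_pos (by norm_num) hγ
  set z₁ := s ^ (-γ) + ε / 2 with hz₁
  set z₂ := max (s ^ (-γ) - ε) (s ^ (-γ) / 2) with hz₂
  have hz₂0 : 0 < z₂ := lt_max_of_lt_right (by positivity)
  have hz₂1 : z₂ < s ^ (-γ) := max_lt (by linarith) (by linarith)
  have h1 : z₁ ^ (-1 / γ) < s := by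
    conv_rhs => rw [← hinv]
    exact Real.rpow_lt_rpow_of_neg hsγ (by linarith) hneg
  have h2 : s < z₂ ^ (-1 / γ) := by
    conv_lhs => rw [← hinv]
    exact Real.rpow_lt_rpow_of_neg hz₂0 hz₂1 hneg
  have hlim := (hA.tendsto_tailEmpirical (z := z₁) (by positivity) (sub_pos.2 h1)).add
    (hA.tendsto_tailEmpirical hz₂0 (half_pos (sub_pos.2 h2)))
  rw [add_zero] at hlim
  have hk1 : ∀ᶠ p : ℕ × ℕ in tailRegime, 1 / (p.2 : ℝ) < (z₂ ^ (-1 / γ) - s) / 2 :=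
    (tendsto_one_div_atTop_nhds_zero_nat.comp tendsto_snd_tailRegime).eventually
      (gt_mem_nhds (half_pos (sub_pos.2 h2)))
  refine tendsto_of_tendsto_of_tendsto_of_le_of_le' tendsto_const_nhds hlim
    (Eventually.of_forall fun _ => zero_le) ?_
  filter_upwards [hk1, hA.tendsto_scale.eventually_gt_atTop 0,
    tendsto_snd_tailRegime.eventually_gt_atTop 0] with p hp hb hk
  have hk' : (0 : ℝ) < p.2 := by exact_mod_cast hk
  refine (measure_mono fun ω hω => ?_).trans (measure_union_le _ _)
  rcases le_abs.1 (show ε ≤ |tailQuantile P X p.1 p.2 s ω - s ^ (-γ)| from hω) with h | h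
  · left
    have h3 : z₁ < tailQuantile P X p.1 p.2 s ω := by linarith
    rw [tailQuantile, lt_absOrderStat_div_scale_iff hk hb (by positivity)] at h3
    have h4 := (Nat.le_ceil ((p.2 : ℝ) * s)).trans_lt h3
    have h5 := lt_of_mul_lt_mul_left h4 hk'.le
    rw [Set.mem_ofPred_eq, le_abs]
    left
    linarith
  · right
    have h3 : ¬ z₂ < tailQuantile P X p.1 p.2 s ω := not_lt.2 <|
      le_trans (by linarith) (le_max_left _ _)
    rw [tailQuantile, lt_absOrderStat_div_scale_iff hk hb hz₂0.le, not_lt] at h3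
    have h4 := h3.trans_lt (Nat.ceil_lt_add_one (by positivity : 0 ≤ (p.2 : ℝ) * s))
    have h5 : tailEmpirical P X p.1 p.2 z₂ ω < s + 1 / p.2 := by
      refine lt_of_mul_lt_mul_left (h4.trans_eq ?_) hk'.le
      field_simp
    rw [Set.mem_ofPred_eq, le_abs]
    right
    linarith

/-- Off an event of vanishing probability the tail quantile process is uniformly close to its limit
on a compact interval. -/
lemma BasicAssumptions.tendsto_not_forall_tailQuantile
    (hA : BasicAssumptions P γ π₁ π₂ L c Z X) {a b ε : ℝ} (ha : 0 < a) (hε : 0 < ε) :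
    Tendsto (fun p : ℕ × ℕ => P {ω | ¬ ∀ s ∈ Set.Icc a b,
      |tailQuantile P X p.1 p.2 s ω - s ^ (-γ)| < ε}) tailRegime (𝓝 0) := by
  have hγ := hA.gamma_pos
  obtain ⟨G, hG0, hG⟩ := exists_finset_forall_abs_sub_lt (f := fun s : ℝ => s ^ (-γ)) (a := a)
    (b := b) (ε := ε)
    (fun s hs => (Real.continuousAt_rpow_const _ _ (Or.inl (ne_of_gt hs))).continuousWithinAt)
    (fun s hs t _ hst => Real.rpow_le_rpow_of_nonpos hs hst (by linarith)) ha hε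
  have hlim : Tendsto (fun p : ℕ × ℕ => ∑ g ∈ G,
      P {ω | ε / 2 ≤ |tailQuantile P X p.1 p.2 g ω - g ^ (-γ)|}) tailRegime (𝓝 0) := by
    simpa using tendsto_finsetSum G fun g hg => hA.tendsto_tailQuantile (hG0 g hg) (half_pos hε)
  refine tendsto_of_tendsto_of_tendsto_of_le_of_le' tendsto_const_nhds hlim
    (Eventually.of_forall fun _ => zero_le) ?_
  filter_upwards [hA.tendsto_scale.eventually_gt_atTop 0,
    tendsto_snd_tailRegime.eventually_gt_atTop 0] with p hb hk
  refine (measure_mono fun ω hω => ?_).trans (measure_biUnion_finset_le G _)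
  by_contra hcon
  simp only [Set.mem_iUnion, Set.mem_ofPred_eq, not_exists, not_le] at hcon
  exact hω (hG _ (tailQuantile_antitone hk hb ω) hcon)

lemma BasicAssumptions.tendsto_iSup_edist_tailQuantile
    (hA : BasicAssumptions P γ π₁ π₂ L c Z X) {a b : ℝ} (ha : 0 < a) {ε : ℝ≥0∞} (hε : 0 < ε) :
    Tendsto (fun p : ℕ × ℕ => P {ω | ε ≤ ⨆ s ∈ Set.Icc a b,
        edist (tailQuantile P X p.1 p.2 s ω) (s ^ (-γ))}) tailRegime (𝓝 0) := by
  obtain ⟨δ, hδ0, hδ⟩ := ENNReal.lt_iff_exists_nnreal_btwn.1 hε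
  refine tendsto_of_tendsto_of_tendsto_of_le_of_le tendsto_const_nhds
    (hA.tendsto_not_forall_tailQuantile (b := b) ha (ENNReal.coe_pos.1 hδ0))
    (fun _ => zero_le) fun p => measure_mono fun ω hω hgood => ?_
  refine absurd hδ (not_lt.2 (le_trans hω (iSup₂_le fun s hs => ?_)))
  rw [edist_dist, Real.dist_eq, ← ENNReal.ofReal_coe_nnreal]
  exact ENNReal.ofReal_le_ofReal (hgood s hs).le

end Uniform

section Skorokhod

namespace SkorokhodD

lemma toReal_inv_one_add_le_one (x : ℝ≥0∞) : ((1 + x)⁻¹).toReal ≤ 1 := by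
  refine ENNReal.toReal_le_of_le_ofReal zero_le_one ?_
  rw [ENNReal.ofReal_one, ENNReal.inv_le_one]
  exact le_self_add

lemma valueDist_le_one (x y : ℝ≥0∞) : valueDist x y ≤ 1 := by
  rw [valueDist, edist_dist, Real.dist_eq, ENNReal.ofReal_le_one, abs_le]
  have hx := toReal_inv_one_add_le_one x
  have hy := toReal_inv_one_add_le_one y
  have hx0 : 0 ≤ ((1 + x)⁻¹).toReal := ENNReal.toReal_nonneg
  have hy0 : 0 ≤ ((1 + y)⁻¹).toReal := ENNReal.toReal_nonneg
  constructor <;> linarith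

lemma valueDist_le_of_le {M : ℝ} (hM : 0 < M) {x y : ℝ≥0∞} (hx : ENNReal.ofReal M ≤ x)
    (hy : ENNReal.ofReal M ≤ y) : valueDist x y ≤ ENNReal.ofReal (1 / M) := by
  have h : ∀ w : ℝ≥0∞, ENNReal.ofReal M ≤ w → ((1 + w)⁻¹).toReal ≤ 1 / M := fun w hw => by
    refine ENNReal.toReal_le_of_le_ofReal (by positivity) ?_
    rw [one_div, ENNReal.ofReal_inv_of_pos hM]
    exact ENNReal.inv_le_inv.2 (hw.trans le_add_self)
  have hx1 := h x hx
  have hy1 := h y hy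
  have hx0 : 0 ≤ ((1 + x)⁻¹).toReal := ENNReal.toReal_nonneg
  have hy0 : 0 ≤ ((1 + y)⁻¹).toReal := ENNReal.toReal_nonneg
  rw [valueDist, edist_dist, Real.dist_eq]
  refine ENNReal.ofReal_le_ofReal (abs_le.2 ⟨?_, ?_⟩) <;> linarith

lemma valueDist_ofReal_le {x y : ℝ} (hx : 0 ≤ x) (hy : 0 ≤ y) :
    valueDist (ENNReal.ofReal x) (ENNReal.ofReal y) ≤ ENNReal.ofReal |x - y| := by
  have h : ∀ w : ℝ, 0 ≤ w → ((1 + ENNReal.ofReal w)⁻¹).toReal = (1 + w)⁻¹ := fun w hw => by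
    rw [ENNReal.toReal_inv, ENNReal.toReal_add ENNReal.one_ne_top ENNReal.ofReal_ne_top,
      ENNReal.toReal_one, ENNReal.toReal_ofReal hw]
  rw [valueDist, h x hx, h y hy, edist_dist, Real.dist_eq]
  refine ENNReal.ofReal_le_ofReal ?_
  have h1 : (1 + x)⁻¹ - (1 + y)⁻¹ = (y - x) / ((1 + x) * (1 + y)) := by
    field_simp
    ring
  rw [h1, abs_div, abs_of_pos (by positivity : 0 < (1 + x) * (1 + y)), abs_sub_comm]
  exact div_le_self (abs_nonneg _) (by nlinarith [mul_nonneg hx hy])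

lemma timeChangeSize_refl : timeChangeSize (OrderIso.refl ℝ≥0) = 0 := by
  simp only [timeChangeSize, ENNReal.iSup_eq_zero]
  intro s t hst
  have h : ((t : ℝ) - s) ≠ 0 := sub_ne_zero.2 (by exact_mod_cast hst.ne')
  simp [div_self h]

lemma lintegral_exp_neg_Ioi (u : ℝ) :
    ∫⁻ v in Set.Ioi u, ENNReal.ofReal (Real.exp (-v)) = ENNReal.ofReal (Real.exp (-u)) := by
  rw [← ofReal_integral_eq_lintegral_ofReal (integrableOn_exp_neg_Ioi u)
    (ae_of_all _ fun v => (Real.exp_pos _).le), integral_exp_neg_Ioi]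

/-- The Skorokhod distance is controlled by the uniform distance on `[0, u]`. -/
lemma edist_le_add_exp (x y : SkorokhodD) {u : ℝ} {C : ℝ≥0∞}
    (h : ∀ t : ℝ≥0, (t : ℝ) ≤ u → valueDist (x.toFun t) (y.toFun t) ≤ C) :
    edist x y ≤ C + ENNReal.ofReal (Real.exp (-u)) := by
  refine (iInf_le _ (OrderIso.refl ℝ≥0)).trans ?_
  rw [timeChangeSize_refl, max_eq_right zero_le]
  set f : ℝ → ℝ≥0∞ := fun v => ⨆ t : ℝ≥0, valueDist (x.toFun (min t v.toNNReal))
    (y.toFun (min t v.toNNReal)) with hf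
  have hsub : Set.Ioi (0 : ℝ) ⊆ Set.Ioc 0 u ∪ Set.Ioi u := fun v hv => by
    rcases le_or_gt v u with h1 | h1
    · exact Or.inl ⟨hv, h1⟩
    · exact Or.inr h1
  calc ∫⁻ v in Set.Ioi (0 : ℝ), ENNReal.ofReal (Real.exp (-v)) * f v
      ≤ ∫⁻ v in Set.Ioc 0 u ∪ Set.Ioi u, ENNReal.ofReal (Real.exp (-v)) * f v :=
        lintegral_mono_set hsub
    _ ≤ (∫⁻ v in Set.Ioc 0 u, ENNReal.ofReal (Real.exp (-v)) * f v) +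
          ∫⁻ v in Set.Ioi u, ENNReal.ofReal (Real.exp (-v)) * f v := lintegral_union_le _ _ _
    _ ≤ C + ENNReal.ofReal (Real.exp (-u)) := by
        refine add_le_add ?_ ?_
        · calc ∫⁻ v in Set.Ioc 0 u, ENNReal.ofReal (Real.exp (-v)) * f v
              ≤ ∫⁻ v in Set.Ioc 0 u, ENNReal.ofReal (Real.exp (-v)) * C := by
                refine setLIntegral_mono' measurableSet_Ioc fun v hv => ?_
                gcongr
                refine iSup_le fun t => h _ ?_
                rw [NNReal.coe_min, Real.coe_toNNReal _ hv.1.le]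
                exact (min_le_right _ _).trans hv.2
            _ ≤ ∫⁻ v in Set.Ioi (0 : ℝ), ENNReal.ofReal (Real.exp (-v)) * C :=
                lintegral_mono_set Set.Ioc_subset_Ioi_self
            _ = C := by
                rw [lintegral_mul_const _ (by fun_prop), lintegral_exp_neg_Ioi]
                simp
        · rw [← lintegral_exp_neg_Ioi]
          refine lintegral_mono fun v => ?_
          exact mul_le_of_le_one_right' (iSup_le fun t => valueDist_le_one _ _)

lemma power_toFun_of_pos (γ : ℝ) {t : ℝ≥0} (ht : 0 < t) :
    (power γ).toFun t = ENNReal.ofReal ((t : ℝ) ^ (-γ)) := by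
  rw [← ENNReal.ofReal_rpow_of_pos (by exact_mod_cast ht), ENNReal.ofReal_coe_nnreal]
  rfl

/-- An antitone path that is close to `s ↦ s^{-γ}` on `[a, u]` is close to it in `D[0,∞)`. -/
lemma edist_power_le {γ : ℝ} (hγ : 0 < γ) (x : SkorokhodD) {T : ℝ → ℝ} (hT : Antitone T)
    (hT0 : ∀ s, 0 ≤ T s) (hx : ∀ t : ℝ≥0, x.toFun t = ENNReal.ofReal (T t)) {a u ε : ℝ}
    (hε : 0 < ε) (ha : 0 < a) (hau : a ≤ u) (haε : 1 / ε + ε ≤ a ^ (-γ))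
    (h : ∀ s ∈ Set.Icc a u, |T s - s ^ (-γ)| < ε) :
    edist x (power γ) ≤ ENNReal.ofReal ε + ENNReal.ofReal (Real.exp (-u)) := by
  refine edist_le_add_exp _ _ fun t ht => ?_
  rcases le_or_gt a t with hat | hat
  · have ht0 : (0 : ℝ) < t := ha.trans_le hat
    rw [hx, power_toFun_of_pos γ (by exact_mod_cast ht0)]
    exact (valueDist_ofReal_le (hT0 _) (by positivity)).trans
      (ENNReal.ofReal_le_ofReal (h t ⟨hat, ht⟩).le)
  · have h1 := valueDist_le_of_le (M := 1 / ε) (by positivity) (x := x.toFun t)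
      (y := (power γ).toFun t) ?_ ?_
    · rwa [one_div_one_div] at h1
    · rw [hx]
      refine ENNReal.ofReal_le_ofReal ?_
      have h2 := (abs_lt.1 (h a ⟨le_rfl, hau⟩)).1
      have h3 := hT hat.le
      linarith
    · rcases eq_zero_or_pos t with rfl | ht0
      · simp [power, hγ]
      · rw [power_toFun_of_pos γ ht0]
        refine ENNReal.ofReal_le_ofReal ?_
        have h2 : a ^ (-γ) ≤ (t : ℝ) ^ (-γ) :=
          Real.rpow_le_rpow_of_nonpos (by exact_mod_cast ht0) hat.le (by linarith)
        linarith

end SkorokhodD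

variable {Ω : Type*} [MeasurableSpace Ω] {P : Measure Ω} [IsProbabilityMeasure P]
  {γ π₁ π₂ : ℝ} {L : ℝ → ℝ} {c : ℕ → ℝ} {Z X : ℤ → Ω → ℝ}

lemma BasicAssumptions.tendstoInMeasure_tailQuantilePath
    (hA : BasicAssumptions P γ π₁ π₂ L c Z X) :
    TendstoInMeasure P (fun (p : ℕ × ℕ) ω => tailQuantilePath P X p.1 p.2 ω) tailRegime
      (fun _ => SkorokhodD.power γ) := by
  have hγ := hA.gamma_pos
  intro ε hε
  obtain ⟨δ, hδ0, hδ⟩ := ENNReal.lt_iff_exists_nnreal_btwn.1 hε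
  have hδ0 : (0 : ℝ) < δ := ENNReal.coe_pos.1 hδ0
  have hδ2 : (0 : ℝ) < δ / 2 := by positivity
  obtain ⟨a, ⟨ha1, ha2⟩, ha0⟩ := (((tendsto_rpow_neg_nhdsGT_zero (neg_lt_zero.2 hγ)).eventually_ge_atTop
    (1 / (δ / 2 : ℝ) + δ / 2)).and (nhdsWithin_le_nhds (gt_mem_nhds one_pos))).and
      self_mem_nhdsWithin |>.exists
  obtain ⟨u, hu1, hu2⟩ := ((Real.tendsto_exp_neg_atTop_nhds_zero.eventually
    (gt_mem_nhds hδ2)).and (eventually_ge_atTop 1)).exists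
  refine tendsto_of_tendsto_of_tendsto_of_le_of_le' tendsto_const_nhds
    (hA.tendsto_not_forall_tailQuantile (b := u) (show 0 < a from ha0) hδ2)
    (Eventually.of_forall fun _ => zero_le) ?_
  filter_upwards [hA.tendsto_scale.eventually_gt_atTop 0,
    tendsto_snd_tailRegime.eventually_gt_atTop 0] with p hb hk
  refine measure_mono fun ω hω hgood => ?_
  have h1 := SkorokhodD.edist_power_le hγ (tailQuantilePath P X p.1 p.2 ω)
    (tailQuantile_antitone hk hb ω) (fun s => tailQuantile_nonneg hb s ω) (fun _ => rfl) hδ2 ha0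
    (le_of_lt (lt_of_lt_of_le ha2 hu2)) ha1 hgood
  refine absurd hδ (not_lt.2 (le_trans hω (h1.trans ?_)))
  rw [← ENNReal.ofReal_add hδ2.le (Real.exp_pos _).le, ← ENNReal.ofReal_coe_nnreal]
  exact ENNReal.ofReal_le_ofReal (by linarith)

end Skorokhod

theorem lemma1 {Ω : Type*} [MeasurableSpace Ω] (P : Measure Ω) [IsProbabilityMeasure P]
    (γ π₁ π₂ : ℝ) (L : ℝ → ℝ) (c : ℕ → ℝ) (Z X : ℤ → Ω → ℝ)
    (hA : BasicAssumptions P γ π₁ π₂ L c Z X) :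
    -- (a)
    (∀ z : ℝ, 0 < z →
      TendstoInMeasure P (fun (p : ℕ × ℕ) ω => tailEmpirical P X p.1 p.2 z ω) tailRegime
        (fun _ => z ^ (-1 / γ))) ∧
    -- (b) in `D[0,∞)`
    TendstoInMeasure P (fun (p : ℕ × ℕ) ω => tailQuantilePath P X p.1 p.2 ω) tailRegime
      (fun _ => SkorokhodD.power γ) ∧
    -- (b) for the finite values: uniformly on compact subintervals of `(0,∞)`
    (∀ a b : ℝ, 0 < a → a ≤ b → ∀ ε : ℝ≥0∞, 0 < ε →
      Tendsto (fun p : ℕ × ℕ => P {ω | ε ≤ ⨆ s ∈ Set.Icc a b,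
        edist (tailQuantile P X p.1 p.2 s ω) (s ^ (-γ))}) tailRegime (𝓝 0)) := by
  exact ⟨fun z hz => hA.tendstoInMeasure_tailEmpirical hz, hA.tendstoInMeasure_tailQuantilePath,
    fun a b ha _ ε hε => hA.tendsto_iSup_edist_tailQuantile ha hε⟩
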